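/- Let $n\ge 1$. A cube is a closed cube $Q\subset\mathbb R^n$ with sides parallel to the axes and sidelength $\ell(Q)>0$; $f_Q=\frac1{|Q|}\int_Q f$ is the average of $f$ over $Q$. For an open set $U\subset\mathbb R^n$, a real-valued function $f$ integrable on every cube $Q\subset U$, and $t,\lambda>0$, put $$\omega_U(f,t)=\sup_{Q\subset U,\ \ell(Q)<t}\frac1{|Q|}\int_Q|f-f_Q|\,dx,\qquad \|f\|_{\mathrm{bmo}_\lambda(U)}=\omega_U(f,\lambda)+\sup_{Q\subset U,\ \ell(Q)\ge\lambda}|f|_Q ,$$ where a supremum over an empty family is $0$, and let $\mathrm{bmo}_\lambda(U)$ be the set of those $f$ for which this (semi)norm is finite. Let $\epsilon\in(0,1]$, $\delta>0$, and let $\Omega\subset\mathbb R^n$ be an $(\epsilon,\delta)$-domain, that is, a nonempty connected open set such that any $x,y\in\Omega$ with $|x-y|<\delta$ are joined by a rectifiable curve $\gamma\subset\Omega$ of length at most $\epsilon^{-1}|x-y|$ with $$\mathrm{dist}(z,\partial\Omega)\ \ge\ \epsilon\,\frac{|z-x|\,|z-y|}{|x-y|}\qquad\text{for all } z\in\gamma$$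 (the right-hand side is read as $0$ if $x=y$, and the distance to the empty set is $\infty$). Put $\lambda=\lambda_{\epsilon,\delta}=\frac{\epsilon^2\delta}{320\,n\,(1+\sqrt n\,\epsilon)}$ and $\mathrm{bmo}(\Omega)=\mathrm{bmo}_{\lambda}(\Omega)$; closures and approximation are with respect to $\|\cdot\|_{\mathrm{bmo}_\lambda(\Omega)}$. Let $f\in\mathrm{bmo}(\Omega)$. Then $f$ can be approximated in $\mathrm{bmo}(\Omega)$ by bounded Lipschitz functions $g$ on $\Omega$ with $\mathrm{dist}(\mathrm{supp}\,g,\partial\Omega)>0$ if and only if $$\lim_{t\to0^+}\omega_\Omega(f,t)=0.\qquad(*)$$ Moreover, the following are equivalent: (i) $f$ belongs to $\mathrm{cmo}(\Omega)$, the closure in $\mathrm{bmo}(\Omega)$ of the space $C_c(\Omega)$ of continuous functions with compact support in $\Omega$; (ii) $f$ belongs to the closure in $\mathrm{bmo}(\Omega)$ of the space $C_c^\infty(\Omega)$ of smooth functions with compact support in $\Omega$; (iii) $f$ vanishes at infinity, i.e. $\lim_{R\to\infty}\|f\|_{\mathrm{bmo}_\lambda(\Omega\setminus\overline{B(0,R)})}=0$,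 and $(*)$ holds. -/

import Mathlib

open Set Filter Topology MeasureTheory
open scoped ENNReal NNReal

noncomputable section

namespace LocalBmo

/-- Euclidean space `ℝⁿ`, with the Euclidean distance. -/
abbrev Eucl (n : ℕ) : Type := EuclideanSpace ℝ (Fin n)

/-- The closed cube with sides parallel to the axes, center `c` and sidelength `l`. -/
def cube {n : ℕ} (c : Eucl n) (l : ℝ) : Set (Eucl n) :=
  {x | ∀ i, |x i - c i| ≤ l / 2}

/-- The average of `|f|` over a set `Q`. -/
def absAvg {n : ℕ} (f : Eucl n → ℝ) (Q : Set (Eucl n)) : ℝ≥0∞ :=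
  ⨍⁻ x in Q, ‖f x‖ₑ ∂volume

/-- The mean oscillation of `f` on a set `Q`: the average over `Q` of `|f - f_Q|`, where `f_Q` is
the average of `f` over `Q`. -/
def meanOsc {n : ℕ} (f : Eucl n → ℝ) (Q : Set (Eucl n)) : ℝ≥0∞ :=
  ⨍⁻ x in Q, ‖f x - ⨍ y in Q, f y ∂volume‖ₑ ∂volume

/-- The modulus of mean oscillation on `Ω`: the supremum of the mean oscillations of `f` over the
cubes contained in `Ω` of sidelength less than `t`. -/
def modulus {n : ℕ} (Ω : Set (Eucl n)) (f : Eucl n → ℝ) (t : ℝ) : ℝ≥0∞ :=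
  ⨆ (c : Eucl n) (l : ℝ) (_ : 0 < l ∧ l < t ∧ cube c l ⊆ Ω), meanOsc f (cube c l)

/-- The norm of `bmo_lam(Ω)`, with value `∞` allowed. -/
def bmoNorm {n : ℕ} (Ω : Set (Eucl n)) (lam : ℝ) (f : Eucl n → ℝ) : ℝ≥0∞ :=
  modulus Ω f lam +
    ⨆ (c : Eucl n) (l : ℝ) (_ : 0 < l ∧ lam ≤ l ∧ cube c l ⊆ Ω), absAvg f (cube c l)

/-- The space `bmo_lam(Ω)`: functions integrable on every cube contained in `Ω`, with finite norm.
Functions are defined on the whole space, but only their values on `Ω` matter. -/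
def bmoSpace {n : ℕ} (Ω : Set (Eucl n)) (lam : ℝ) : Set (Eucl n → ℝ) :=
  {f | (∀ (c : Eucl n) (l : ℝ), 0 < l → cube c l ⊆ Ω → IntegrableOn f (cube c l)) ∧
    bmoNorm Ω lam f < ⊤}

/-- The closure in `bmo_lam(Ω)`, with respect to its norm, of a family `S` of functions. -/
def bmoClosure {n : ℕ} (Ω : Set (Eucl n)) (lam : ℝ) (S : Set (Eucl n → ℝ)) :
    Set (Eucl n → ℝ) :=
  {f | f ∈ bmoSpace Ω lam ∧
    ∀ η : ℝ≥0∞, 0 < η → ∃ g ∈ S, g ∈ bmoSpace Ω lam ∧ bmoNorm Ω lam (f - g) < η}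

/-- Bounded Lipschitz functions on `Ω` whose support has positive distance to the boundary of `Ω`
(the distance to the empty set is infinite). -/
def lipBoundedAway {n : ℕ} (Ω : Set (Eucl n)) : Set (Eucl n → ℝ) :=
  {g | (∃ M : ℝ, ∀ x ∈ Ω, |g x| ≤ M) ∧ (∃ K : ℝ≥0, LipschitzOnWith K g Ω) ∧
    ∃ r : ℝ≥0∞, 0 < r ∧ ∀ x ∈ Ω, g x ≠ 0 → r ≤ Metric.infEDist x (frontier Ω)}

/-- `C_c(Ω)`: continuous functions with compact support in `Ω`, extended by zero. -/
def contCompactSupp {n : ℕ} (Ω : Set (Eucl n)) : Set (Eucl n → ℝ) :=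
  {g | Continuous g ∧ HasCompactSupport g ∧ tsupport g ⊆ Ω}

/-- `C_c^∞(Ω)`: smooth functions with compact support in `Ω`, extended by zero. -/
def smoothCompactSupp {n : ℕ} (Ω : Set (Eucl n)) : Set (Eucl n → ℝ) :=
  {g | ContDiff ℝ ((⊤ : ℕ∞) : WithTop ℕ∞) g ∧ HasCompactSupport g ∧ tsupport g ⊆ Ω}

/-- The Sarason-type vanishing mean oscillation condition on `Ω`. -/
def VanishingMeanOsc {n : ℕ} (Ω : Set (Eucl n)) (f : Eucl n → ℝ) : Prop :=
  Tendsto (fun t : ℝ => modulus Ω f t) (𝓝[>] 0) (𝓝 0)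

/-- `f` vanishes at infinity in the sense of `bmo_lam(Ω)`. -/
def VanishesAtInfinity {n : ℕ} (Ω : Set (Eucl n)) (lam : ℝ) (f : Eucl n → ℝ) : Prop :=
  Tendsto (fun R : ℝ => bmoNorm (Ω \ Metric.closedBall 0 R) lam f) atTop (𝓝 0)

/-- `(ε, δ)`-domains: nonempty connected open sets in which points at distance less than `δ` are
joined by a rectifiable curve of controlled length staying away from the boundary. -/
structure IsEpsDeltaDomain {n : ℕ} (ε δ : ℝ) (Ω : Set (Eucl n)) : Prop where
  isOpen : IsOpen Ω
  isConnected : IsConnected Ω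
  exists_curve : ∀ x ∈ Ω, ∀ y ∈ Ω, dist x y < δ →
    ∃ γ : ℝ → Eucl n, ContinuousOn γ (Icc 0 1) ∧ γ 0 = x ∧ γ 1 = y ∧
      MapsTo γ (Icc 0 1) Ω ∧
      eVariationOn γ (Icc 0 1) ≤ ENNReal.ofReal (ε⁻¹ * dist x y) ∧
      ∀ s ∈ Icc (0 : ℝ) 1,
        ENNReal.ofReal (ε * (dist (γ s) x * dist (γ s) y / dist x y)) ≤
          Metric.infEDist (γ s) (frontier Ω)

/-- The natural scale `ε² δ / (320 n (1 + √n ε))` of an `(ε, δ)`-domain. -/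
def scale (n : ℕ) (ε δ : ℝ) : ℝ :=
  ε ^ 2 * δ / (320 * n * (1 + √(n : ℝ) * ε))

end LocalBmo

end

/-!
The approximating functions are built directly in `Ω`, without extending `f` as a `bmo` function.
Four facts carry it.

*Growth of averages* (`exists_absAvg_le_logWeight`). Two points of an `(ε, δ)`-domain whose
distances to the boundary are comparable to their mutual distance are joined by boundedly many
overlapping cubes of comparable size, placed along the curve of the definition; moreover every
point has, at every small scale `ρ`, a neighbor at distance at most `ρ` lying at distance at least
`ε ρ / 4` from the boundary. Halving the scale therefore changes averages of `|f|` by a bounded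
amount, so that `|f|_Q ≤ C (1 + log⁺ (1 / ℓ(Q)))` for all cubes `Q ⊆ Ω`. The precise value of `λ`
matters here only: when `Ω` is large, cubes of side `λ`, on which the norm controls `|f|_Q`, are
available near every point, and otherwise all chains can be led to one fixed cube.

*Cutting off near the boundary* (`exists_boundary_cutoff`). Let `d` be the distance to the
boundary, truncated at `1`. Over a cube of side `ℓ` the function `log (1 + log (1 / d))` has mean
oscillation `O(1 / (1 + log⁺ (1 / ℓ)))`, which exactly compensates the growth of averages. A cutoff
`φ` which varies slowly with respect to it satisfies `osc_Q (f φ) ≤ 2 osc_Q f + small`, so `f - f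
φ` has small oscillation on small cubes. On the other cubes, `f - f φ` lives in a thin boundary
layer, covered by few cells of a grid, and the growth estimate on those cells makes its average
small.

*Mollification* (`exists_smooth_approx`). Extended by zero, `f φ` has small oscillation on all
small cubes of the whole space, so its mollification is close to it; the result is smooth, bounded,
Lipschitz and supported at positive distance from the boundary.

*Cutting off at infinity* (`exists_radialCutoff_approx`). If `f` vanishes at infinity, a radial
cutoff with small Lipschitz constant `κ` changes `f` little, because the product of the growth
bound with the oscillation `O(κ ℓ)` of the cutoff is at most `O(κ)`.

The converse implications hold because uniformly continuous functions have vanishing mean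
oscillation, a property preserved by limits in the norm.
-/

noncomputable section

namespace LocalBmo

variable {n : ℕ}

/-! ### Cubes -/

lemma mem_cube {c x : Eucl n} {l : ℝ} : x ∈ cube c l ↔ ∀ i, |x i - c i| ≤ l / 2 := Iff.rfl

lemma abs_sub_apply_le_dist (x y : Eucl n) (i : Fin n) : |x i - y i| ≤ dist x y := by
  rw [dist_eq_norm]
  simpa using PiLp.norm_apply_le (x - y) i

lemma cube_subset_cube {c c' : Eucl n} {l l' : ℝ} (h : ∀ i, |c i - c' i| ≤ (l' - l) / 2) :
    cube c l ⊆ cube c' l' := by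
  intro x hx i
  have h1 := hx i
  have h2 := h i
  have h3 := abs_sub_le (x i) (c i) (c' i)
  linarith

lemma cube_subset_cube_of_dist {c c' : Eucl n} {l l' : ℝ} (h : dist c c' ≤ (l' - l) / 2) :
    cube c l ⊆ cube c' l' :=
  cube_subset_cube fun i => (abs_sub_apply_le_dist c c' i).trans h

lemma cube_mono {c : Eucl n} {l l' : ℝ} (h : l ≤ l') : cube c l ⊆ cube c l' := fun x hx i =>
  (hx i).trans (by linarith)

lemma center_mem_cube {c : Eucl n} {l : ℝ} (h : 0 ≤ l) : c ∈ cube c l := fun i => by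
  simp; linarith

lemma mem_cube_of_dist_le {c x : Eucl n} {l : ℝ} (h : dist x c ≤ l / 2) : x ∈ cube c l :=
  fun i => (abs_sub_apply_le_dist x c i).trans h

lemma dist_le_of_mem_cube {c x : Eucl n} {l : ℝ} (hl : 0 ≤ l) (hx : x ∈ cube c l) :
    dist x c ≤ √n * (l / 2) := by
  rw [EuclideanSpace.dist_eq]
  calc √(∑ i, dist (x i) (c i) ^ 2) ≤ √(∑ _i : Fin n, (l / 2) ^ 2) := by
        apply Real.sqrt_le_sqrt
        refine Finset.sum_le_sum fun i _ => ?_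
        have := hx i
        rw [Real.dist_eq]
        gcongr
    _ = √n * (l / 2) := by
        rw [Finset.sum_const, Finset.card_univ, Fintype.card_fin, nsmul_eq_mul,
          Real.sqrt_mul (by positivity), Real.sqrt_sq (by positivity)]

lemma isClosed_cube (c : Eucl n) (l : ℝ) : IsClosed (cube c l) := by
  have : cube c l = ⋂ i, {x : Eucl n | |x i - c i| ≤ l / 2} := by
    ext x; simp [mem_cube]
  rw [this]
  refine isClosed_iInter fun i => isClosed_le ?_ continuous_const
  fun_prop

lemma measurableSet_cube (c : Eucl n) (l : ℝ) : MeasurableSet (cube c l) :=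
  (isClosed_cube c l).measurableSet

lemma volume_cube (c : Eucl n) (l : ℝ) : volume (cube c l) = ENNReal.ofReal l ^ n := by
  have h : cube c l = (MeasurableEquiv.toLp 2 (Fin n → ℝ)).symm ⁻¹'
      (Icc (fun i => c i - l / 2) (fun i => c i + l / 2)) := by
    ext x
    simp only [mem_cube, mem_preimage, mem_Icc, Pi.le_def, abs_le, ← forall_and]
    refine forall_congr' fun i => ?_
    have : (MeasurableEquiv.toLp 2 (Fin n → ℝ)).symm x i = x i := rfl
    rw [this]
    constructor <;> rintro ⟨h1, h2⟩ <;> constructor <;> linarith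
  rw [h, (EuclideanSpace.volume_preserving_symm_measurableEquiv_toLp (Fin n)).measure_preimage
    measurableSet_Icc.nullMeasurableSet, Real.volume_Icc_pi]
  simp

lemma volume_cube_ne_top (c : Eucl n) (l : ℝ) : volume (cube c l) ≠ ⊤ := by
  rw [volume_cube]; finiteness

lemma volume_cube_ne_zero (c : Eucl n) {l : ℝ} (hl : 0 < l) : volume (cube c l) ≠ 0 := by
  rw [volume_cube]
  exact pow_ne_zero _ (by simpa using hl)

lemma volume_cube_div (c c' : Eucl n) {l l' : ℝ} (hl : 0 < l) :
    volume (cube c' l') / volume (cube c l) = ENNReal.ofReal (l' / l) ^ n := by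
  rw [volume_cube, volume_cube, ENNReal.ofReal_div_of_pos hl, div_eq_mul_inv, div_eq_mul_inv,
    mul_pow, ENNReal.inv_pow]

/-! ### Averages and mean oscillations -/

lemma laverage_le_of_le {Q : Set (Eucl n)} (hQ : MeasurableSet Q) {h : Eucl n → ℝ≥0∞} {C : ℝ≥0∞}
    (hC : ∀ x ∈ Q, h x ≤ C) : ⨍⁻ x in Q, h x ∂volume ≤ C := by
  rw [setLAverage_eq]
  calc (∫⁻ x in Q, h x) / volume Q ≤ (C * volume Q) / volume Q := by
        gcongr
        calc ∫⁻ x in Q, h x ≤ ∫⁻ _ in Q, C := setLIntegral_mono' hQ hC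
          _ = C * volume Q := by simp
    _ ≤ C := ENNReal.div_le_of_le_mul le_rfl

lemma setLAverage_mono_on {Q : Set (Eucl n)} (hQ : MeasurableSet Q) {g h : Eucl n → ℝ≥0∞}
    (hgh : ∀ x ∈ Q, g x ≤ h x) : ⨍⁻ x in Q, g x ∂volume ≤ ⨍⁻ x in Q, h x ∂volume := by
  rw [setLAverage_eq, setLAverage_eq]
  exact ENNReal.div_le_div_right (setLIntegral_mono' hQ hgh) _

lemma setLAverage_const_mul {Q : Set (Eucl n)} {r : ℝ≥0∞} (hr : r ≠ ⊤) (h : Eucl n → ℝ≥0∞) :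
    ⨍⁻ x in Q, r * h x ∂volume = r * ⨍⁻ x in Q, h x ∂volume :=
  lintegral_const_mul' _ _ hr

lemma setLIntegral_le_of_laverage_le {Q : Set (Eucl n)} (hQ : volume Q ≠ ⊤)
    {h : Eucl n → ℝ≥0∞} {C : ℝ≥0∞} (hC : ⨍⁻ x in Q, h x ∂volume ≤ C) :
    ∫⁻ x in Q, h x ≤ C * volume Q := by
  rw [← measure_mul_setLAverage h hQ, mul_comm]
  gcongr

lemma laverage_le_mul_laverage {Q Q' : Set (Eucl n)} (hsub : Q ⊆ Q') (hQ' : volume Q' ≠ ⊤)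
    (h : Eucl n → ℝ≥0∞) :
    ⨍⁻ x in Q, h x ∂volume ≤ volume Q' / volume Q * ⨍⁻ x in Q', h x ∂volume := by
  rw [setLAverage_eq, ← ENNReal.mul_div_right_comm, measure_mul_setLAverage h hQ']
  gcongr

lemma enorm_average_sub_le {Q : Set (Eucl n)} (hQ0 : volume Q ≠ 0) (hQ : volume Q ≠ ⊤)
    {h : Eucl n → ℝ} (hh : IntegrableOn h Q) (a : ℝ) :
    ‖(⨍ y in Q, h y) - a‖ₑ ≤ ⨍⁻ x in Q, ‖h x - a‖ₑ ∂volume := by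
  have : IsFiniteMeasure (volume.restrict Q) := ⟨by simpa using hQ.lt_top⟩
  have : NeZero (volume.restrict Q) := ⟨by simpa using hQ0⟩
  have h1 : (⨍ y in Q, h y) - a = ⨍ y in Q, (h y - a) := by
    rw [average, average, integral_sub hh.to_average (integrable_const a), ← average,
      ← average, average_const]
  rw [h1]
  exact enorm_integral_le_lintegral_enorm _

lemma enorm_average_le {Q : Set (Eucl n)} (h : Eucl n → ℝ) :
    ‖⨍ y in Q, h y‖ₑ ≤ absAvg h Q :=
  enorm_integral_le_lintegral_enorm _

lemma setLAverage_add {Q : Set (Eucl n)} {g h : Eucl n → ℝ≥0∞}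
    (hg : AEMeasurable g (volume.restrict Q)) :
    ⨍⁻ x in Q, (g x + h x) ∂volume = (⨍⁻ x in Q, g x ∂volume) + ⨍⁻ x in Q, h x ∂volume :=
  lintegral_add_left' (hg.smul_measure _) _

lemma laverage_enorm_sub_le {Q : Set (Eucl n)} {h : Eucl n → ℝ} (hh : IntegrableOn h Q)
    (hQ0 : volume Q ≠ 0) (hQ : volume Q ≠ ⊤) (a b : ℝ) :
    ⨍⁻ x in Q, ‖h x - b‖ₑ ∂volume ≤ (⨍⁻ x in Q, ‖h x - a‖ₑ ∂volume) + ‖a - b‖ₑ := by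
  calc ⨍⁻ x in Q, ‖h x - b‖ₑ ∂volume ≤ ⨍⁻ x in Q, (‖h x - a‖ₑ + ‖a - b‖ₑ) ∂volume := by
        refine lintegral_mono fun x => ?_
        have : h x - b = (h x - a) + (a - b) := by ring
        rw [this]
        exact enorm_add_le _ _
    _ = _ := by
        rw [setLAverage_add, setLAverage_const hQ0 hQ]
        exact (hh.aestronglyMeasurable.sub aestronglyMeasurable_const).enorm

lemma meanOsc_le_two_mul {Q : Set (Eucl n)} {h : Eucl n → ℝ} (hh : IntegrableOn h Q)
    (hQ0 : volume Q ≠ 0) (hQ : volume Q ≠ ⊤) (a : ℝ) :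
    meanOsc h Q ≤ 2 * ⨍⁻ x in Q, ‖h x - a‖ₑ ∂volume := by
  refine (laverage_enorm_sub_le hh hQ0 hQ a _).trans ?_
  rw [two_mul]
  gcongr
  rw [← enorm_neg, neg_sub]
  exact enorm_average_sub_le hQ0 hQ hh a

lemma meanOsc_le_two_mul_absAvg {Q : Set (Eucl n)} {h : Eucl n → ℝ} (hh : IntegrableOn h Q)
    (hQ0 : volume Q ≠ 0) (hQ : volume Q ≠ ⊤) : meanOsc h Q ≤ 2 * absAvg h Q := by
  simpa [absAvg] using meanOsc_le_two_mul hh hQ0 hQ 0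

lemma absAvg_le_meanOsc_add {Q : Set (Eucl n)} {h : Eucl n → ℝ} (hh : IntegrableOn h Q)
    (hQ0 : volume Q ≠ 0) (hQ : volume Q ≠ ⊤) : absAvg h Q ≤ meanOsc h Q + ‖⨍ y in Q, h y‖ₑ := by
  simpa [absAvg, meanOsc] using laverage_enorm_sub_le hh hQ0 hQ (⨍ y in Q, h y) 0

lemma meanOsc_add_le {Q : Set (Eucl n)} {g h : Eucl n → ℝ} (hg : IntegrableOn g Q)
    (hh : IntegrableOn h Q) : meanOsc (g + h) Q ≤ meanOsc g Q + meanOsc h Q := by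
  have h1 : ⨍ y in Q, (g + h) y = (⨍ y in Q, g y) + ⨍ y in Q, h y :=
    integral_add hg.to_average hh.to_average
  unfold meanOsc
  rw [h1, ← setLAverage_add]
  · refine lintegral_mono fun x => ?_
    have : (g + h) x - ((⨍ y in Q, g y) + ⨍ y in Q, h y) =
      (g x - ⨍ y in Q, g y) + (h x - ⨍ y in Q, h y) := by simp; ring
    rw [this]
    exact enorm_add_le _ _
  · exact (hg.aestronglyMeasurable.sub aestronglyMeasurable_const).enorm

lemma meanOsc_neg (h : Eucl n → ℝ) (Q : Set (Eucl n)) : meanOsc (-h) Q = meanOsc h Q := by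
  unfold meanOsc
  have : ⨍ y in Q, (-h) y = -⨍ y in Q, h y := integral_neg _
  rw [this]
  refine lintegral_congr fun x => ?_
  rw [← enorm_neg]
  congr 1
  simp; ring

lemma meanOsc_sub_le {Q : Set (Eucl n)} {g h : Eucl n → ℝ} (hg : IntegrableOn g Q)
    (hh : IntegrableOn h Q) : meanOsc (g - h) Q ≤ meanOsc g Q + meanOsc h Q := by
  rw [sub_eq_add_neg, ← meanOsc_neg h]
  exact meanOsc_add_le hg hh.neg

lemma absAvg_add_le {Q : Set (Eucl n)} {g h : Eucl n → ℝ} (hg : IntegrableOn g Q) :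
    absAvg (g + h) Q ≤ absAvg g Q + absAvg h Q := by
  unfold absAvg
  rw [← setLAverage_add hg.aestronglyMeasurable.enorm]
  exact lintegral_mono fun x => enorm_add_le _ _

lemma meanOsc_congr {Q : Set (Eucl n)} (hQ : MeasurableSet Q) {g h : Eucl n → ℝ}
    (e : EqOn g h Q) : meanOsc g Q = meanOsc h Q := by
  unfold meanOsc
  have h1 : ⨍ y in Q, g y = ⨍ y in Q, h y :=
    setAverage_congr_fun hQ (Eventually.of_forall fun x hx => e hx)
  rw [h1]
  exact setLAverage_congr_fun hQ fun x hx => by simp only [e hx]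

lemma absAvg_congr {Q : Set (Eucl n)} (hQ : MeasurableSet Q) {g h : Eucl n → ℝ}
    (e : EqOn g h Q) : absAvg g Q = absAvg h Q :=
  setLAverage_congr_fun hQ fun x hx => by simp only [e hx]

@[simp] lemma meanOsc_zero (Q : Set (Eucl n)) : meanOsc 0 Q = 0 := by
  simp [meanOsc]

@[simp] lemma absAvg_zero (Q : Set (Eucl n)) : absAvg 0 Q = 0 := by simp [absAvg]

/-- Multiplication by a function `φ` bounded by `1` costs, apart from the oscillation of `f`, only
the size of the average of `f` times the oscillation of `φ`. -/
lemma meanOsc_mul_le {Q : Set (Eucl n)} (hQm : MeasurableSet Q) {f φ : Eucl n → ℝ}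
    (hf : IntegrableOn f Q) (hfφ : IntegrableOn (f * φ) Q)
    (hφ : ∀ x ∈ Q, |φ x| ≤ 1) (hQ0 : volume Q ≠ 0) (hQ : volume Q ≠ ⊤) (a : ℝ) :
    meanOsc (f * φ) Q ≤ 2 * (meanOsc f Q + absAvg f Q * ⨍⁻ x in Q, ‖φ x - a‖ₑ ∂volume) := by
  refine (meanOsc_le_two_mul hfφ hQ0 hQ ((⨍ y in Q, f y) * a)).trans ?_
  gcongr
  calc ⨍⁻ x in Q, ‖(f * φ) x - (⨍ y in Q, f y) * a‖ₑ ∂volume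
      ≤ ⨍⁻ x in Q, (‖f x - ⨍ y in Q, f y‖ₑ + ‖⨍ y in Q, f y‖ₑ * ‖φ x - a‖ₑ) ∂volume := by
        refine setLAverage_mono_on hQm fun x hx => ?_
        have : (f * φ) x - (⨍ y in Q, f y) * a =
          (f x - ⨍ y in Q, f y) * φ x + (⨍ y in Q, f y) * (φ x - a) := by simp; ring
        rw [this]
        refine (enorm_add_le _ _).trans ?_
        rw [enorm_mul, enorm_mul]
        gcongr
        refine mul_le_of_le_one_right' ?_
        rw [Real.enorm_eq_ofReal_abs]
        simpa using hφ x hx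
    _ = meanOsc f Q + ‖⨍ y in Q, f y‖ₑ * ⨍⁻ x in Q, ‖φ x - a‖ₑ ∂volume := by
        rw [setLAverage_add]
        · congr 1
          exact lintegral_const_mul' _ _ (by simp)
        · exact (hf.aestronglyMeasurable.sub aestronglyMeasurable_const).enorm
    _ ≤ _ := by
        gcongr
        exact enorm_average_le f

/-! ### The modulus of oscillation and the norm -/

lemma meanOsc_le_modulus {Ω : Set (Eucl n)} (f : Eucl n → ℝ) {t l : ℝ} {c : Eucl n} (hl : 0 < l)
    (hlt : l < t) (h : cube c l ⊆ Ω) : meanOsc f (cube c l) ≤ modulus Ω f t :=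
  le_iSup₂_of_le c l (le_iSup_of_le ⟨hl, hlt, h⟩ le_rfl)

lemma modulus_le {Ω : Set (Eucl n)} {f : Eucl n → ℝ} {t : ℝ} {A : ℝ≥0∞}
    (h : ∀ c l, 0 < l → l < t → cube c l ⊆ Ω → meanOsc f (cube c l) ≤ A) : modulus Ω f t ≤ A :=
  iSup₂_le fun c l => iSup_le fun ⟨h1, h2, h3⟩ => h c l h1 h2 h3

lemma modulus_mono (Ω : Set (Eucl n)) (f : Eucl n → ℝ) {s t : ℝ} (h : s ≤ t) :
    modulus Ω f s ≤ modulus Ω f t :=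
  modulus_le fun _ _ h1 h2 h3 => meanOsc_le_modulus f h1 (h2.trans_le h) h3

lemma meanOsc_le_bmoNorm {Ω : Set (Eucl n)} (f : Eucl n → ℝ) {lam l : ℝ} {c : Eucl n} (hl : 0 < l)
    (hlt : l < lam) (h : cube c l ⊆ Ω) : meanOsc f (cube c l) ≤ bmoNorm Ω lam f :=
  (meanOsc_le_modulus f hl hlt h).trans le_self_add

lemma absAvg_le_bmoNorm {Ω : Set (Eucl n)} (f : Eucl n → ℝ) {lam l : ℝ} {c : Eucl n} (hl : 0 < l)
    (hlt : lam ≤ l) (h : cube c l ⊆ Ω) : absAvg f (cube c l) ≤ bmoNorm Ω lam f :=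
  (le_iSup₂_of_le (f := fun (c : Eucl n) (l : ℝ) =>
    ⨆ (_ : 0 < l ∧ lam ≤ l ∧ cube c l ⊆ Ω), absAvg f (cube c l)) c l
    (le_iSup_of_le ⟨hl, hlt, h⟩ le_rfl)).trans le_add_self

lemma bmoNorm_le {Ω : Set (Eucl n)} {f : Eucl n → ℝ} {lam : ℝ} {A B : ℝ≥0∞}
    (hA : ∀ c l, 0 < l → l < lam → cube c l ⊆ Ω → meanOsc f (cube c l) ≤ A)
    (hB : ∀ c l, 0 < l → lam ≤ l → cube c l ⊆ Ω → absAvg f (cube c l) ≤ B) :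
    bmoNorm Ω lam f ≤ A + B :=
  add_le_add (modulus_le hA) (iSup₂_le fun c l => iSup_le fun ⟨h1, h2, h3⟩ => hB c l h1 h2 h3)

lemma bmoNorm_congr {Ω : Set (Eucl n)} {f g : Eucl n → ℝ} (lam : ℝ) (h : EqOn f g Ω) :
    bmoNorm Ω lam f ≤ bmoNorm Ω lam g :=
  bmoNorm_le
    (fun _ _ h1 h2 h3 => (meanOsc_congr (measurableSet_cube _ _) (h.mono h3)).trans_le
      (meanOsc_le_modulus g h1 h2 h3))
    (fun c l h1 h2 h3 => (absAvg_congr (measurableSet_cube _ _) (h.mono h3)).trans_le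
      (le_iSup₂_of_le c l (le_iSup_of_le ⟨h1, h2, h3⟩ le_rfl)))

lemma bmoNorm_mono {Ω Ω' : Set (Eucl n)} (h : Ω ⊆ Ω') (lam : ℝ) (f : Eucl n → ℝ) :
    bmoNorm Ω lam f ≤ bmoNorm Ω' lam f :=
  bmoNorm_le (fun _ _ h1 h2 h3 => meanOsc_le_modulus f h1 h2 (h3.trans h))
    (fun c l h1 h2 h3 => le_iSup₂_of_le c l (le_iSup_of_le ⟨h1, h2, h3.trans h⟩ le_rfl))

lemma bmoNorm_add_le {Ω : Set (Eucl n)} {lam : ℝ} {f g : Eucl n → ℝ}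
    (hf : ∀ (c : Eucl n) (l : ℝ), 0 < l → cube c l ⊆ Ω → IntegrableOn f (cube c l))
    (hg : ∀ (c : Eucl n) (l : ℝ), 0 < l → cube c l ⊆ Ω → IntegrableOn g (cube c l)) :
    bmoNorm Ω lam (f + g) ≤ bmoNorm Ω lam f + bmoNorm Ω lam g := by
  unfold bmoNorm
  rw [add_add_add_comm]
  refine bmoNorm_le (fun c l h1 h2 h3 => ?_) (fun c l h1 h2 h3 => ?_)
  · exact (meanOsc_add_le (hf c l h1 h3) (hg c l h1 h3)).trans
      (add_le_add (meanOsc_le_modulus f h1 h2 h3) (meanOsc_le_modulus g h1 h2 h3))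
  · exact (absAvg_add_le (hf c l h1 h3)).trans
      (add_le_add (le_iSup₂_of_le c l (le_iSup_of_le ⟨h1, h2, h3⟩ le_rfl))
        (le_iSup₂_of_le c l (le_iSup_of_le ⟨h1, h2, h3⟩ le_rfl)))

/-! ### Comparing averages over nested cubes -/

lemma laverage_cube_le_mul {c c' : Eucl n} {l l' A : ℝ} (hl : 0 < l)
    (hsub : cube c l ⊆ cube c' l') (hA : l' ≤ A * l) (h : Eucl n → ℝ≥0∞) :
    ⨍⁻ x in cube c l, h x ∂volume ≤
      ENNReal.ofReal A ^ n * ⨍⁻ x in cube c' l', h x ∂volume := by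
  refine (laverage_le_mul_laverage hsub (volume_cube_ne_top _ _) h).trans ?_
  rw [volume_cube_div _ _ hl]
  gcongr
  rwa [div_le_iff₀ hl]

lemma absAvg_cube_le_of_superset {f : Eucl n → ℝ} {c c' : Eucl n} {l l' A : ℝ} (hl : 0 < l)
    (hsub : cube c l ⊆ cube c' l') (hA : l' ≤ A * l)
    (hf : IntegrableOn f (cube c' l')) :
    absAvg f (cube c l) ≤
      absAvg f (cube c' l') + ENNReal.ofReal A ^ n * meanOsc f (cube c' l') := by
  have h1 := laverage_enorm_sub_le (hf.mono_set hsub) (volume_cube_ne_zero c hl)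
    (volume_cube_ne_top c l) (⨍ y in cube c' l', f y) 0
  simp only [sub_zero] at h1
  refine h1.trans ?_
  rw [add_comm]
  gcongr
  · exact enorm_average_le f
  · exact laverage_cube_le_mul hl hsub hA _

lemma absAvg_cube_le_of_subset {f : Eucl n → ℝ} {c c' : Eucl n} {l l' A : ℝ} (hl : 0 < l)
    (hl' : 0 < l') (hsub : cube c l ⊆ cube c' l') (hA : l' ≤ A * l)
    (hf : IntegrableOn f (cube c' l')) :
    absAvg f (cube c' l') ≤
      absAvg f (cube c l) + (1 + ENNReal.ofReal A ^ n) * meanOsc f (cube c' l') := by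
  set a' := ⨍ y in cube c' l', f y with ha'
  set a := ⨍ y in cube c l, f y with ha
  have h1 := absAvg_le_meanOsc_add hf (volume_cube_ne_zero c' hl') (volume_cube_ne_top c' l')
  have h2 : ‖a'‖ₑ ≤ ‖a‖ₑ + ‖a - a'‖ₑ := by
    have : a' = a - (a - a') := by ring
    calc ‖a'‖ₑ = ‖a - (a - a')‖ₑ := by rw [← this]
      _ ≤ _ := enorm_sub_le
  have h3 := enorm_average_sub_le (volume_cube_ne_zero c hl) (volume_cube_ne_top c l)
    (hf.mono_set hsub) a'
  have h4 := laverage_cube_le_mul hl hsub hA (fun x => ‖f x - a'‖ₑ)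
  calc absAvg f (cube c' l') ≤ meanOsc f (cube c' l') + ‖a'‖ₑ := h1
    _ ≤ meanOsc f (cube c' l') +
        (absAvg f (cube c l) + ENNReal.ofReal A ^ n * meanOsc f (cube c' l')) := by
        gcongr
        exact h2.trans (add_le_add (enorm_average_le f) (h3.trans h4))
    _ = _ := by ring

/-! ### Subdivision of a cube into a grid -/

/-- The center of the cell with index `i` when `cube c l` is divided into `N ^ n` congruent cubes
of sidelength `l / N`. -/
def gridCenter (c : Eucl n) (l : ℝ) (N : ℕ) (i : Fin n → Fin N) : Eucl n :=
  WithLp.toLp 2 fun j => c j - l / 2 + ((i j : ℕ) + 1 / 2 : ℝ) * (l / N)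

lemma exists_fin_le_le_add_one {N : ℕ} (hN : 0 < N) {t : ℝ} (h0 : 0 ≤ t) (h1 : t ≤ N) :
    ∃ k : Fin N, (k : ℕ) ≤ t ∧ t ≤ (k : ℕ) + 1 := by
  by_cases h : ⌊t⌋₊ < N
  · exact ⟨⟨_, h⟩, Nat.floor_le h0, (Nat.lt_floor_add_one t).le⟩
  · have h2 : (N : ℝ) ≤ t := (Nat.le_floor_iff h0).1 (not_lt.1 h)
    have h3 : ((N - 1 : ℕ) : ℝ) = N - 1 := by
      rw [Nat.cast_sub hN]; simp
    refine ⟨⟨N - 1, by omega⟩, ?_, ?_⟩ <;> simp only [h3] <;> linarith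

lemma gridCell_subset {c : Eucl n} {l : ℝ} (hl : 0 < l) {N : ℕ} (i : Fin n → Fin N) :
    cube (gridCenter c l N i) (l / N) ⊆ cube c l := by
  refine cube_subset_cube fun j => ?_
  have hi : ((i j : ℕ) : ℝ) + 1 ≤ N := by exact_mod_cast (i j).2
  have hN : (0 : ℝ) < N := by
    have : (0 : ℝ) ≤ (i j : ℕ) := by positivity
    linarith
  have hr : 0 < l / N := by positivity
  have hl' : l = N * (l / N) := by field_simp
  set r := l / N
  simp only [gridCenter, abs_le]
  have h0 : (0 : ℝ) ≤ (i j : ℕ) := by positivity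
  constructor <;> nlinarith

lemma exists_mem_gridCell {c x : Eucl n} {l : ℝ} (hl : 0 < l) {N : ℕ} (hN : 0 < N)
    (hx : x ∈ cube c l) : ∃ i : Fin n → Fin N, x ∈ cube (gridCenter c l N i) (l / N) := by
  have hN' : (0 : ℝ) < N := by exact_mod_cast hN
  have hr : 0 < l / N := by positivity
  have hl' : l = N * (l / N) := by field_simp
  have : ∀ j, ∃ k : Fin N, ((k : ℕ) : ℝ) ≤ (x j - c j + l / 2) / (l / N) ∧
      (x j - c j + l / 2) / (l / N) ≤ (k : ℕ) + 1 := by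
    intro j
    have h := abs_le.1 (hx j)
    refine exists_fin_le_le_add_one hN ?_ ?_
    · apply div_nonneg _ hr.le; linarith
    · rw [div_le_iff₀ hr]; linarith
  choose i hi using this
  refine ⟨i, fun j => ?_⟩
  obtain ⟨h1, h2⟩ := hi j
  rw [le_div_iff₀ hr] at h1
  rw [div_le_iff₀ hr] at h2
  simp only [gridCenter, abs_le]
  constructor <;> nlinarith

lemma setLIntegral_biUnion_finset_le {ι : Type*} (P : Finset ι) (s : ι → Set (Eucl n))
    (h : Eucl n → ℝ≥0∞) : ∫⁻ x in ⋃ i ∈ P, s i, h x ≤ ∑ i ∈ P, ∫⁻ x in s i, h x := by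
  classical
  induction P using Finset.induction_on with
  | empty => simp
  | insert a P ha ih =>
    rw [Finset.sum_insert ha, Finset.set_biUnion_insert]
    exact (lintegral_union_le _ _ _).trans (by gcongr)

/-- If the averages of `h` over the cells of a grid on `cube c l` are at most `B`, so is the
average of `h` over `cube c l`. -/
lemma laverage_cube_le_of_grid {c : Eucl n} {l : ℝ} (hl : 0 < l) {N : ℕ} (hN : 0 < N)
    {h : Eucl n → ℝ≥0∞} {B : ℝ≥0∞}
    (hB : ∀ b, cube b (l / N) ⊆ cube c l → ⨍⁻ x in cube b (l / N), h x ∂volume ≤ B) :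
    ⨍⁻ x in cube c l, h x ∂volume ≤ B := by
  rw [setLAverage_eq]
  refine ENNReal.div_le_of_le_mul ?_
  calc ∫⁻ x in cube c l, h x
      ≤ ∫⁻ x in ⋃ i ∈ (Finset.univ : Finset (Fin n → Fin N)),
          cube (gridCenter c l N i) (l / N), h x := by
        refine lintegral_mono_set fun x hx => ?_
        simpa using exists_mem_gridCell hl hN hx
    _ ≤ ∑ i : Fin n → Fin N, ∫⁻ x in cube (gridCenter c l N i) (l / N), h x :=
        setLIntegral_biUnion_finset_le _ _ _
    _ ≤ ∑ _i : Fin n → Fin N, B * ENNReal.ofReal (l / N) ^ n := by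
        refine Finset.sum_le_sum fun i _ => ?_
        rw [← volume_cube]
        exact setLIntegral_le_of_laverage_le (volume_cube_ne_top _ _) (hB _ (gridCell_subset hl i))
    _ = B * volume (cube c l) := by
        rw [Finset.sum_const, Finset.card_univ, Fintype.card_fun, Fintype.card_fin,
          Fintype.card_fin, nsmul_eq_mul, volume_cube, mul_left_comm]
        congr 1
        have hN' : (0 : ℝ) < N := by exact_mod_cast hN
        rw [ENNReal.ofReal_div_of_pos hN', ENNReal.ofReal_natCast, Nat.cast_pow, ← mul_pow,
          ENNReal.mul_div_cancel (by simp [hN.ne']) (by simp)]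

/-- If the averages of `h` over the cells of a grid on `cube c l` are at most `B`, then
the average over `cube c l` of the part of `h` outside the inner cells is at most `2 n B / N`: only
`N ^ n - (N - 2) ^ n` cells are involved. -/
lemma laverage_layer_le_of_grid {c : Eucl n} {l : ℝ} (hl : 0 < l) {N : ℕ} (hN : 2 ≤ N)
    {h : Eucl n → ℝ≥0∞} {B : ℝ≥0∞}
    (hB : ∀ b, cube b (l / N) ⊆ cube c l → ⨍⁻ x in cube b (l / N), h x ∂volume ≤ B) :
    ⨍⁻ x in cube c l, (cube c (l - 2 * (l / N)))ᶜ.indicator h x ∂volume ≤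
      ENNReal.ofReal (2 * n / N) * B := by
  classical
  have hN0 : 0 < N := by omega
  have hN' : (0 : ℝ) < N := by exact_mod_cast hN0
  have hr : 0 < l / N := by positivity
  have hl' : l = N * (l / N) := by field_simp
  rw [setLAverage_eq]
  refine ENNReal.div_le_of_le_mul ?_
  set P : Finset (Fin n → Fin N) :=
    (Fintype.piFinset fun _ => Finset.univ.filter fun k : Fin N => 1 ≤ (k : ℕ) ∧ (k : ℕ) + 2 ≤ N)ᶜ
    with hP
  have hcard : (P.card : ℝ) ≤ 2 * n / N * (N : ℝ) ^ n := by
    have h1 : (Finset.univ.filter fun k : Fin N => 1 ≤ (k : ℕ) ∧ (k : ℕ) + 2 ≤ N).card = N - 2 := by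
      have : (Finset.univ.filter fun k : Fin N => 1 ≤ (k : ℕ) ∧ (k : ℕ) + 2 ≤ N).map
          Fin.valEmbedding = Finset.Ico 1 (N - 1) := by
        ext k
        simp only [Finset.mem_map, Finset.mem_filter, Finset.mem_univ, true_and,
          Fin.valEmbedding_apply, Finset.mem_Ico]
        constructor
        · rintro ⟨a, ⟨h1, h2⟩, rfl⟩; omega
        · rintro ⟨h1, h2⟩; exact ⟨⟨k, by omega⟩, ⟨h1, by simp only []; omega⟩, rfl⟩
      rw [← Finset.card_map Fin.valEmbedding, this, Nat.card_Ico]; omega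
    rw [hP, Finset.card_compl, Fintype.card_piFinset, Fintype.card_fun]
    simp only [h1, Finset.prod_const, Finset.card_univ, Fintype.card_fin]
    have h3 : (N - 2) ^ n ≤ N ^ n := Nat.pow_le_pow_left (by omega) n
    push_cast [Nat.cast_sub h3, Nat.cast_sub hN]
    have h4 : (N : ℝ) - 2 = N * (1 + (-2 / N)) := by field_simp; ring
    have h5 : (2 : ℝ) ≤ N := by exact_mod_cast hN
    have h6 : 1 + (n : ℝ) * (-2 / N) ≤ (1 + (-2 / N : ℝ)) ^ n := by
      refine one_add_mul_le_pow ?_ n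
      rw [le_div_iff₀ hN']; linarith
    rw [h4, mul_pow]
    have h7 : (0 : ℝ) < N ^ n := by positivity
    have h8 : 2 * (n : ℝ) / N = - (n * (-2 / N)) := by ring
    rw [h8]
    nlinarith
  calc ∫⁻ x in cube c l, (cube c (l - 2 * (l / N)))ᶜ.indicator h x
      = ∫⁻ x in (cube c (l - 2 * (l / N)))ᶜ ∩ cube c l, h x := by
        rw [setLIntegral_indicator (measurableSet_cube _ _).compl]
    _ ≤ ∫⁻ x in ⋃ i ∈ P, cube (gridCenter c l N i) (l / N), h x := by
        refine lintegral_mono_set fun x hx => ?_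
        obtain ⟨i, hi⟩ := exists_mem_gridCell hl hN0 hx.2
        simp only [mem_iUnion]
        refine ⟨i, ?_, hi⟩
        rw [hP, Finset.mem_compl, Fintype.mem_piFinset]
        intro hall
        refine hx.1 fun j => ?_
        have h1 := hi j
        have h2 := hall j
        simp only [Finset.mem_filter, Finset.mem_univ, true_and] at h2
        have h3 : (1 : ℝ) ≤ (i j : ℕ) := by exact_mod_cast h2.1
        have h4 : ((i j : ℕ) : ℝ) + 2 ≤ N := by exact_mod_cast h2.2
        simp only [gridCenter, abs_le] at h1 ⊢
        constructor <;> nlinarith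
    _ ≤ ∑ i ∈ P, ∫⁻ x in cube (gridCenter c l N i) (l / N), h x :=
        setLIntegral_biUnion_finset_le _ _ _
    _ ≤ ∑ _i ∈ P, B * ENNReal.ofReal (l / N) ^ n := by
        refine Finset.sum_le_sum fun i _ => ?_
        rw [← volume_cube]
        exact setLIntegral_le_of_laverage_le (volume_cube_ne_top _ _) (hB _ (gridCell_subset hl i))
    _ = ENNReal.ofReal P.card * (B * ENNReal.ofReal (l / N) ^ n) := by
        rw [Finset.sum_const, nsmul_eq_mul, ENNReal.ofReal_natCast]
    _ ≤ ENNReal.ofReal (2 * n / N * (N : ℝ) ^ n) * (B * ENNReal.ofReal (l / N) ^ n) := by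
        gcongr
    _ = ENNReal.ofReal (2 * n / N) * B * volume (cube c l) := by
        rw [ENNReal.ofReal_mul (by positivity), volume_cube, mul_assoc, mul_assoc]
        congr 1
        rw [mul_left_comm]
        congr 1
        rw [ENNReal.ofReal_pow hN'.le, ← mul_pow, ← ENNReal.ofReal_mul hN'.le, ← hl']

/-! ### Distance to the boundary -/

lemma ofReal_le_infEDist_frontier {Ω : Set (Eucl n)} (hΩ : IsOpen Ω) {c x : Eucl n} {l l' : ℝ}
    (hsub : cube c l ⊆ Ω) (hx : x ∈ cube c l') :
    ENNReal.ofReal ((l - l') / 2) ≤ Metric.infEDist x (frontier Ω) := by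
  refine Metric.le_infEDist.2 fun y hy => ?_
  rw [hΩ.frontier_eq] at hy
  have hy' : y ∉ cube c l := fun h => hy.2 (hsub h)
  rw [mem_cube] at hy'
  push Not at hy'
  obtain ⟨i, hi⟩ := hy'
  rw [edist_dist]
  apply ENNReal.ofReal_le_ofReal
  have h1 := abs_sub_apply_le_dist x y i
  have h2 := hx i
  have h3 := abs_sub_le (y i) (x i) (c i)
  rw [abs_sub_comm (y i) (x i)] at h3
  linarith

lemma ball_subset_of_le_infEDist {Ω : Set (Eucl n)} (hΩ : IsOpen Ω) {x : Eucl n} (hx : x ∈ Ω)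
    {r : ℝ} (h : ENNReal.ofReal r ≤ Metric.infEDist x (frontier Ω)) : Metric.ball x r ⊆ Ω := by
  intro y hy
  have hr : 0 < r := Metric.pos_of_mem_ball hy
  refine (convex_ball x r).isPreconnected.subset_of_closure_inter_subset hΩ
    ⟨x, Metric.mem_ball_self hr, hx⟩ (fun z hz => ?_) hy
  by_contra hzΩ
  have h1 : z ∈ frontier Ω := by rw [hΩ.frontier_eq]; exact ⟨hz.1, hzΩ⟩
  have h2 := h.trans (Metric.infEDist_le_edist_of_mem h1)
  rw [edist_dist, ENNReal.ofReal_le_ofReal_iff dist_nonneg, dist_comm] at h2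
  exact absurd hz.2 (by simpa using h2)

lemma cube_subset_of_le_infEDist {Ω : Set (Eucl n)} (hΩ : IsOpen Ω) {x : Eucl n} (hx : x ∈ Ω)
    {r l : ℝ} (hl : 0 ≤ l) (h : ENNReal.ofReal r ≤ Metric.infEDist x (frontier Ω))
    (hlr : √n * (l / 2) < r) : cube x l ⊆ Ω := fun _ hy =>
  ball_subset_of_le_infEDist hΩ hx h ((dist_le_of_mem_cube hl hy).trans_lt hlr)

lemma ofReal_sub_le_infEDist {s : Set (Eucl n)} {x z : Eucl n} {a b : ℝ} (hb : dist x z ≤ b)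
    (h : ENNReal.ofReal a ≤ Metric.infEDist x s) :
    ENNReal.ofReal (a - b) ≤ Metric.infEDist z s := by
  rw [ENNReal.ofReal_sub _ (dist_nonneg.trans hb), tsub_le_iff_right]
  refine (h.trans (Metric.infEDist_le_infEDist_add_edist (y := z))).trans ?_
  gcongr
  rw [edist_dist]
  exact ENNReal.ofReal_le_ofReal hb

lemma exists_pos_ofReal_le_infEDist {Ω : Set (Eucl n)} (hΩ : IsOpen Ω) {x : Eucl n} (hx : x ∈ Ω) :
    ∃ r : ℝ, 0 < r ∧ ENNReal.ofReal r ≤ Metric.infEDist x (frontier Ω) := by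
  have h0 : x ∉ closure (frontier Ω) := by
    rw [isClosed_frontier.closure_eq, hΩ.frontier_eq]
    exact fun h => h.2 hx
  have h1 : 0 < Metric.infEDist x (frontier Ω) := by
    rw [pos_iff_ne_zero]
    exact fun h => h0 (Metric.mem_closure_iff_infEDist_zero.2 h)
  obtain ⟨r, hr0, hr⟩ := ENNReal.lt_iff_exists_nnreal_btwn.1 h1
  refine ⟨r, by exact_mod_cast hr0, ?_⟩
  rw [ENNReal.ofReal_coe_nnreal]
  exact hr.le

/-! ### Chains of cubes along curves -/

/-- The increment of the average of `|f|` allowed in one step of a chain of cubes, when `M` bounds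
the mean oscillations of `f`. -/
def hopCost (n : ℕ) (M : ℝ≥0∞) : ℝ≥0∞ := (1 + 2 * 2 ^ n) * M

lemma absAvg_hop {Ω : Set (Eucl n)} {lam : ℝ} {f : Eucl n → ℝ} (hf : f ∈ bmoSpace Ω lam)
    {x y : Eucl n} {r : ℝ} (hr : 0 < r) (hrl : 2 * r < lam) (hx : cube x (2 * r) ⊆ Ω)
    (hxy : dist x y ≤ r / 2) :
    absAvg f (cube y r) ≤ absAvg f (cube x r) + hopCost n (bmoNorm Ω lam f) := by
  have h1 : cube y r ⊆ cube x (2 * r) := cube_subset_cube_of_dist (by rw [dist_comm]; linarith)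
  have h2 : cube x r ⊆ cube x (2 * r) := cube_mono (by linarith)
  have hi := hf.1 x (2 * r) (by linarith) hx
  have hM := meanOsc_le_bmoNorm f (by linarith) hrl hx
  calc absAvg f (cube y r)
      ≤ absAvg f (cube x (2 * r)) + ENNReal.ofReal 2 ^ n * meanOsc f (cube x (2 * r)) :=
        absAvg_cube_le_of_superset hr h1 le_rfl hi
    _ ≤ absAvg f (cube x r) + (1 + ENNReal.ofReal 2 ^ n) * meanOsc f (cube x (2 * r)) +
        ENNReal.ofReal 2 ^ n * meanOsc f (cube x (2 * r)) := by
        gcongr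
        exact absAvg_cube_le_of_subset hr (by linarith) h2 le_rfl hi
    _ = absAvg f (cube x r) + (1 + 2 * 2 ^ n) * meanOsc f (cube x (2 * r)) := by
        simp only [ENNReal.ofReal_ofNat]; ring
    _ ≤ _ := by unfold hopCost; gcongr

/-- Along a curve around which cubes of side `2 r` stay in `Ω`, the average of `|f|` grows by at
most one step per length `r / 2`. -/
lemma absAvg_le_along_curve {Ω : Set (Eucl n)} {lam : ℝ} {f : Eucl n → ℝ}
    (hf : f ∈ bmoSpace Ω lam) {r : ℝ} (hr : 0 < r) (hrl : 2 * r < lam) {γ : ℝ → Eucl n}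
    (hγ : ContinuousOn γ (Icc 0 1)) (hsub : ∀ s ∈ Icc (0 : ℝ) 1, cube (γ s) (2 * r) ⊆ Ω) (k : ℕ) :
    ∀ s ∈ Icc (0 : ℝ) 1, eVariationOn γ (Icc 0 s) ≤ ENNReal.ofReal (k * (r / 2)) →
      absAvg f (cube (γ s) r) ≤ absAvg f (cube (γ 0) r) + k * hopCost n (bmoNorm Ω lam f) := by
  induction k with
  | zero =>
    intro s hs hv
    have h1 := eVariationOn.edist_le γ (s := Icc 0 s) (x := 0) (y := s)
      ⟨le_rfl, hs.1⟩ ⟨hs.1, le_rfl⟩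
    have h2 : γ 0 = γ s := by
      rw [← edist_le_zero]
      simpa using h1.trans hv
    simp [h2]
  | succ k ih =>
    intro s hs hv
    have h0 : (0 : ℝ) ∈ Icc (0 : ℝ) 1 := ⟨le_rfl, zero_le_one⟩
    -- either one step suffices, or the last step is taken from a point at distance exactly `r / 2`
    by_cases hd : dist (γ 0) (γ s) ≤ r / 2
    · refine (absAvg_hop hf hr hrl (hsub 0 h0) hd).trans ?_
      gcongr
      refine le_mul_of_one_le_left' ?_
      push_cast
      exact le_add_self
    · push Not at hd
      have hc : ContinuousOn (fun t => dist (γ t) (γ s)) (Icc 0 s) :=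
        (continuous_id.dist continuous_const).comp_continuousOn
          (hγ.mono (Icc_subset_Icc_right hs.2))
      have h1 := intermediate_value_Icc' hs.1 hc
      obtain ⟨t, ht, hts⟩ := h1 (show r / 2 ∈ _ from ⟨by simp only [dist_self]; positivity, hd.le⟩)
      have ht1 : t ∈ Icc (0 : ℝ) 1 := ⟨ht.1, ht.2.trans hs.2⟩
      have h2 := eVariationOn.Icc_add_Icc γ (s := univ) ht.1 ht.2 (mem_univ t)
      simp only [univ_inter] at h2
      have h3 : ENNReal.ofReal (r / 2) ≤ eVariationOn γ (Icc t s) := by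
        rw [← hts, ← edist_dist]
        exact eVariationOn.edist_le γ ⟨le_rfl, ht.2⟩ ⟨ht.2, le_rfl⟩
      have h4 : eVariationOn γ (Icc 0 t) + ENNReal.ofReal (r / 2) ≤
          ENNReal.ofReal (k * (r / 2)) + ENNReal.ofReal (r / 2) := by
        rw [← ENNReal.ofReal_add (by positivity) (by positivity)]
        calc _ ≤ eVariationOn γ (Icc 0 t) + eVariationOn γ (Icc t s) := by gcongr
          _ ≤ _ := by
            rw [h2]
            refine hv.trans_eq ?_
            push_cast; ring_nf
      have h5 := ih t ht1 ((ENNReal.add_le_add_iff_right ENNReal.ofReal_ne_top).1 h4)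
      refine (absAvg_hop hf hr hrl (hsub t ht1) hts.le).trans ?_
      push_cast
      rw [add_mul, one_mul, ← add_assoc]
      gcongr

/-- Two points of an `(ε, δ)`-domain which are far from the boundary, relative to their distance,
are joined by a chain of boundedly many cubes. -/
lemma absAvg_le_of_far_from_frontier {ε δ : ℝ} (hε : 0 < ε) (hε1 : ε ≤ 1) {Ω : Set (Eucl n)}
    (hΩ : IsEpsDeltaDomain ε δ Ω) {lam : ℝ} {f : Eucl n → ℝ} (hf : f ∈ bmoSpace Ω lam)
    {x y : Eucl n} (hx : x ∈ Ω) (hy : y ∈ Ω) {a b : ℝ} (ha : 0 < a) (hab : a ≤ b)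
    (hxy : dist x y ≤ b) (hxyδ : dist x y < δ)
    (hdx : ENNReal.ofReal a ≤ Metric.infEDist x (frontier Ω))
    (hdy : ENNReal.ofReal a ≤ Metric.infEDist y (frontier Ω))
    {r : ℝ} (hr : 0 < r) (hrl : 2 * r < lam) (hra : √n * r < ε * a ^ 2 / (4 * b))
    {k : ℕ} (hk : 2 * (ε⁻¹ * b) ≤ k * r) :
    absAvg f (cube y r) ≤ absAvg f (cube x r) + k * hopCost n (bmoNorm Ω lam f) := by
  obtain ⟨γ, hγ, h0, h1, hmap, hlen, hdist⟩ := hΩ.exists_curve x hx y hy hxyδ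
  have hb : 0 < b := ha.trans_le hab
  have hσ : ε * a ^ 2 / (4 * b) ≤ a - a / 2 := by
    rw [div_le_iff₀ (by positivity)]
    have : ε * a ^ 2 ≤ 1 * a ^ 2 := by gcongr
    nlinarith
  have hfar : ∀ s ∈ Icc (0 : ℝ) 1, ENNReal.ofReal (ε * a ^ 2 / (4 * b)) ≤
      Metric.infEDist (γ s) (frontier Ω) := by
    intro s hs
    by_cases hsx : dist x (γ s) ≤ a / 2
    · exact (ENNReal.ofReal_le_ofReal hσ).trans (ofReal_sub_le_infEDist hsx hdx)
    by_cases hsy : dist y (γ s) ≤ a / 2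
    · exact (ENNReal.ofReal_le_ofReal hσ).trans (ofReal_sub_le_infEDist hsy hdy)
    refine le_trans (ENNReal.ofReal_le_ofReal ?_) (hdist s hs)
    push Not at hsx hsy
    have hpos : 0 < dist x y := by
      refine dist_pos.2 fun hxy' => ?_
      subst hxy'
      have h2 := (eVariationOn.edist_le γ (s := Icc 0 1) (x := 0) (y := s)
        ⟨le_rfl, zero_le_one⟩ hs).trans hlen
      simp only [dist_self, mul_zero, ENNReal.ofReal_zero, nonpos_iff_eq_zero, edist_eq_zero,
        h0] at h2
      rw [← h2, dist_self] at hsx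
      linarith
    rw [dist_comm] at hsx hsy
    calc ε * a ^ 2 / (4 * b) = ε * ((a / 2) * (a / 2) / b) := by ring
      _ ≤ _ := by gcongr
  have hsub : ∀ s ∈ Icc (0 : ℝ) 1, cube (γ s) (2 * r) ⊆ Ω := fun s hs =>
    cube_subset_of_le_infEDist hΩ.isOpen (hmap hs) (by positivity) (hfar s hs) (by
      rwa [mul_div_cancel_left₀ _ two_ne_zero])
  have h2 := absAvg_le_along_curve hf hr hrl hγ hsub k 1 ⟨zero_le_one, le_rfl⟩
    (hlen.trans (ENNReal.ofReal_le_ofReal ?_))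
  · rwa [h0, h1] at h2
  · have : ε⁻¹ * dist x y ≤ ε⁻¹ * b := by gcongr
    linarith

/-- A curve of an `(ε, δ)`-domain between `x` and `y` passes, halfway, far from the boundary. -/
lemma exists_far_from_frontier {ε δ : ℝ} (hε : 0 < ε) {Ω : Set (Eucl n)}
    (hΩ : IsEpsDeltaDomain ε δ Ω) {x y : Eucl n} (hx : x ∈ Ω) (hy : y ∈ Ω)
    (hxyδ : dist x y < δ) : ∃ z ∈ Ω, dist x z ≤ dist x y ∧
      ENNReal.ofReal (ε / 4 * dist x y) ≤ Metric.infEDist z (frontier Ω) := by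
  obtain ⟨γ, hγ, h0, h1, hmap, -, hdist⟩ := hΩ.exists_curve x hx y hy hxyδ
  have hc : ContinuousOn (fun t => dist (γ t) x) (Icc 0 1) :=
    (continuous_id.dist continuous_const).comp_continuousOn hγ
  have hd : 0 ≤ dist x y := dist_nonneg
  obtain ⟨s, hs, hsx⟩ := intermediate_value_Icc zero_le_one hc
    (show dist x y / 2 ∈ _ from ⟨by simp only [h0, dist_self]; positivity,
      by simp only [h1, dist_comm y x]; linarith⟩)
  simp only at hsx
  refine ⟨γ s, hmap hs, by rw [dist_comm, hsx]; linarith, le_trans (ENNReal.ofReal_le_ofReal ?_)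
    (hdist s hs)⟩
  have hsy : dist x y / 2 ≤ dist (γ s) y := by
    have := dist_triangle_left x y (γ s)
    linarith
  rcases hd.eq_or_lt with h | h
  · rw [← h]; simp
  rw [hsx, mul_div_assoc (dist x y / 2) _ (dist x y)]
  calc ε / 4 * dist x y = ε * (dist x y / 2 * (dist x y / 2 / dist x y)) := by field_simp; ring
    _ ≤ _ := by gcongr

lemma exists_corkscrew {ε δ : ℝ} (hε : 0 < ε) {Ω : Set (Eucl n)} (hΩ : IsEpsDeltaDomain ε δ Ω)
    {a b : Eucl n} (ha : a ∈ Ω) (hb : b ∈ Ω) {ρ : ℝ} (hρ : 0 < ρ) (hρδ : ρ < δ)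
    (hab : 2 * ρ ≤ dist a b) {x : Eucl n} (hx : x ∈ Ω) : ∃ z ∈ Ω, dist x z ≤ ρ ∧
      ENNReal.ofReal (ε / 4 * ρ) ≤ Metric.infEDist z (frontier Ω) := by
  obtain ⟨w, hw, hxw⟩ : ∃ w ∈ Ω, ρ ≤ dist x w := by
    by_contra! h
    have h1 := h a ha
    have h2 := h b hb
    have h3 := dist_triangle_left a b x
    linarith
  have hc : ContinuousOn (fun t => dist x t) Ω := (continuous_const.dist continuous_id).continuousOn
  obtain ⟨y, hy, hxy⟩ := hΩ.isConnected.isPreconnected.intermediate_value hx hw hc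
    (show ρ ∈ _ from ⟨by simpa using hρ.le, hxw⟩)
  simp only at hxy
  obtain ⟨z, hz, h1, h2⟩ := exists_far_from_frontier hε hΩ hx hy (by rwa [hxy])
  rw [hxy] at h1 h2
  exact ⟨z, hz, h1, h2⟩

/-! ### Logarithmic growth of averages -/

/-- The weight `1 + log⁺ (1 / t)`, for `t > 0`. -/
def logWeight (t : ℝ) : ℝ := 1 - Real.log (min t 1)

lemma one_le_logWeight {t : ℝ} (ht : 0 < t) : 1 ≤ logWeight t := by
  have := Real.log_nonpos (lt_min ht one_pos).le (min_le_right t 1)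
  unfold logWeight
  linarith

lemma logWeight_pos {t : ℝ} (ht : 0 < t) : 0 < logWeight t := one_pos.trans_le (one_le_logWeight ht)

lemma logWeight_anti {s t : ℝ} (hs : 0 < s) (hst : s ≤ t) : logWeight t ≤ logWeight s := by
  unfold logWeight
  have := Real.log_le_log (lt_min hs one_pos) (min_le_min_right 1 hst)
  linarith

lemma neg_log_le_logWeight {t : ℝ} (ht : 0 < t) : -Real.log t ≤ logWeight t - 1 := by
  unfold logWeight
  have := Real.log_le_log (lt_min ht one_pos) (min_le_left t 1)
  linarith

lemma scale_pos {ε δ : ℝ} (hn : 1 ≤ n) (hε : 0 < ε) (hδ : 0 < δ) : 0 < scale n ε δ := by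
  have : (1 : ℝ) ≤ n := by exact_mod_cast hn
  unfold scale
  positivity

lemma sqrt_mul_scale_lt {ε δ : ℝ} (hn : 1 ≤ n) (hε : 0 < ε) (hε1 : ε ≤ 1) (hδ : 0 < δ) :
    √n * (scale n ε δ / 2) < ε / 4 * (δ / 4) := by
  have h1 : (1 : ℝ) ≤ n := by exact_mod_cast hn
  have h2 : √(n : ℝ) ≤ n := by
    rw [Real.sqrt_le_left (by positivity)]
    nlinarith
  unfold scale
  rw [mul_div_assoc', div_lt_iff₀ (by positivity), mul_div_assoc', div_lt_iff₀ (by positivity)]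
  have h3 : 0 ≤ √(n : ℝ) * ε := by positivity
  have h4 : ε ^ 2 * δ ≤ ε * δ := by nlinarith [mul_pos hε hδ]
  have h5 : 0 < ε * δ := mul_pos hε hδ
  calc √n * (ε ^ 2 * δ) ≤ n * (ε * δ) := by gcongr
    _ < ε / 4 * (δ / 4) * 2 * (320 * n * 1) := by nlinarith
    _ ≤ _ := by gcongr; linarith

lemma absAvg_lt_top {f : Eucl n → ℝ} {Q : Set (Eucl n)} (hf : IntegrableOn f Q) :
    absAvg f Q < ⊤ :=
  setLAverage_lt_top hf.hasFiniteIntegral.ne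

/-- At one fixed scale, the averages over cubes centered far from the boundary are bounded: if the
domain is large there is a cube of side `scale n ε δ` around each such center, otherwise all the
centers are linked to a single one. -/
lemma exists_corkscrew_scale {ε δ : ℝ} (hn : 1 ≤ n) (hε : 0 < ε) (hε1 : ε ≤ 1) (hδ : 0 < δ)
    {Ω : Set (Eucl n)} (hΩ : IsEpsDeltaDomain ε δ Ω) {f : Eucl n → ℝ}
    (hf : f ∈ bmoSpace Ω (scale n ε δ)) :
    ∃ ρ₀ > 0, ρ₀ < δ ∧ (∃ a ∈ Ω, ∃ b ∈ Ω, 2 * ρ₀ ≤ dist a b) ∧ ∃ θ₀ > 0, ∀ r, 0 < r → r ≤ θ₀ →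
      ∃ B < (⊤ : ℝ≥0∞), ∀ p ∈ Ω,
        ENNReal.ofReal (ε / 4 * ρ₀) ≤ Metric.infEDist p (frontier Ω) →
        absAvg f (cube p r) ≤ B := by
  have hlam := scale_pos hn hε hδ
  set lam := scale n ε δ with hlam'
  by_cases hbig : ∃ a ∈ Ω, ∃ b ∈ Ω, δ / 2 ≤ dist a b
  · obtain ⟨a, ha, b, hb, hab⟩ := hbig
    refine ⟨δ / 4, by positivity, by linarith, ⟨a, ha, b, hb, by linarith⟩, lam, hlam,
      fun r hr hrl => ⟨ENNReal.ofReal (lam / r) ^ n * bmoNorm Ω lam f, ?_, fun p hp hd => ?_⟩⟩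
    · exact ENNReal.mul_lt_top (by finiteness) hf.2
    · have hsub : cube p lam ⊆ Ω := cube_subset_of_le_infEDist hΩ.isOpen hp hlam.le hd
        (sqrt_mul_scale_lt hn hε hε1 hδ)
      refine (laverage_cube_le_mul hr (cube_mono hrl) (A := lam / r) ?_ _).trans ?_
      · rw [div_mul_cancel₀ _ hr.ne']
      · gcongr
        exact absAvg_le_bmoNorm f hlam le_rfl hsub
  · push Not at hbig
    obtain ⟨a, ha⟩ := hΩ.isConnected.nonempty
    obtain ⟨b, hb, hab⟩ : ∃ b ∈ Ω, b ≠ a := by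
      have : Nontrivial (Eucl n) := by
        have : Nonempty (Fin n) := ⟨⟨0, hn⟩⟩
        infer_instance
      have := Module.punctured_nhds_neBot ℝ (Eucl n) a
      exact nonempty_of_mem (f := 𝓝[≠] a)
        (inter_mem (mem_nhdsWithin_of_mem_nhds (hΩ.isOpen.mem_nhds ha)) self_mem_nhdsWithin)
    have hpos : 0 < dist b a := dist_pos.2 hab
    have hlt := hbig b hb a ha
    obtain ⟨d, hd0, hd⟩ := exists_pos_ofReal_le_infEDist hΩ.isOpen ha
    set a₀ := min (ε / 4 * (dist b a / 2)) d with ha₀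
    have ha₀pos : 0 < a₀ := by positivity
    have ha₀δ : a₀ ≤ δ / 2 := (min_le_left _ _).trans (by nlinarith)
    set σ := ε * a₀ ^ 2 / (4 * (δ / 2)) with hσ
    have hσpos : 0 < σ := by positivity
    have hn0 : 0 < √(n : ℝ) := by
      have : (0 : ℝ) < n := by exact_mod_cast hn
      positivity
    refine ⟨dist b a / 2, by positivity, by linarith, ⟨b, hb, a, ha, by linarith⟩,
      min (lam / 4) (σ / √n / 2), by positivity, fun r hr hrl => ?_⟩
    have hrl1 : 2 * r < lam := by linarith [hrl.trans (min_le_left _ _)]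
    have hrσ : √n * r < σ := by
      have : r < σ / √n := by
        have : 0 < σ / √n := by positivity
        linarith [hrl.trans (min_le_right _ _)]
      rw [lt_div_iff₀ hn0] at this
      linarith
    obtain ⟨k, hk⟩ := exists_nat_ge (2 * (ε⁻¹ * (δ / 2)) / r)
    rw [div_le_iff₀ hr] at hk
    have hsub : cube a r ⊆ Ω := by
      refine cube_subset_of_le_infEDist hΩ.isOpen ha hr.le hd ?_
      have h1 : σ ≤ a₀ := by
        rw [hσ, div_le_iff₀ (by positivity)]
        nlinarith
      have h2 : √n * (r / 2) ≤ √n * r := by gcongr; linarith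
      linarith [min_le_right (ε / 4 * (dist b a / 2)) d]
    refine ⟨absAvg f (cube a r) + k * hopCost n (bmoNorm Ω lam f), ?_, fun p hp hdp => ?_⟩
    · have h1 := absAvg_lt_top (hf.1 a r hr hsub)
      have h2 := hf.2
      have h3 : hopCost n (bmoNorm Ω lam f) < ⊤ := ENNReal.mul_lt_top (by finiteness) h2
      exact ENNReal.add_lt_top.2 ⟨h1, ENNReal.mul_lt_top (by simp) h3⟩
    · have hap := hbig a ha p hp
      exact absAvg_le_of_far_from_frontier hε hε1 hΩ hf ha hp ha₀pos ha₀δ hap.le (by linarith)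
        ((ENNReal.ofReal_le_ofReal (min_le_right _ _)).trans hd)
        ((ENNReal.ofReal_le_ofReal (min_le_left _ _)).trans hdp) hr hrl1 hrσ hk

/-- Averages over the cubes of an `(ε, δ)`-domain grow at most logarithmically in the reciprocal of
the sidelength: halving the scale costs a bounded number of steps in a chain of cubes. -/
lemma exists_absAvg_le_logWeight {ε δ : ℝ} (hn : 1 ≤ n) (hε : 0 < ε) (hε1 : ε ≤ 1) (hδ : 0 < δ)
    {Ω : Set (Eucl n)} (hΩ : IsEpsDeltaDomain ε δ Ω) {f : Eucl n → ℝ}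
    (hf : f ∈ bmoSpace Ω (scale n ε δ)) :
    ∃ C : ℝ≥0, ∀ c l, 0 < l → cube c l ⊆ Ω →
      absAvg f (cube c l) ≤ C * ENNReal.ofReal (logWeight l) := by
  have hlam := scale_pos hn hε hδ
  obtain ⟨ρ₀, hρ₀, hρ₀δ, ⟨a, ha, b, hb, hab⟩, θ₀, hθ₀, hbase⟩ :=
    exists_corkscrew_scale hn hε hε1 hδ hΩ hf
  set lam := scale n ε δ with hlam'
  set M := bmoNorm Ω lam f with hM
  have hMtop : M < ⊤ := hf.2
  have hn1 : (1 : ℝ) ≤ √n := by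
    rw [Real.one_le_sqrt]; exact_mod_cast hn
  have hn0 : 0 < √(n : ℝ) := by linarith
  -- the sidelengths of the chain at scale `ρ` are `θ * ρ`
  obtain ⟨θ, hθ, hθ1, hθ2, hθ3⟩ : ∃ θ : ℝ, 0 < θ ∧ √n * θ < ε ^ 3 / 256 ∧ 2 * (θ * ρ₀) < lam ∧
      θ * ρ₀ ≤ θ₀ := by
    refine ⟨min (ε ^ 3 / 512 / √n) (min (lam / 4 / ρ₀) (θ₀ / ρ₀)), by positivity, ?_, ?_, ?_⟩
    · calc _ ≤ √n * (ε ^ 3 / 512 / √n) := by gcongr; exact min_le_left _ _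
        _ = ε ^ 3 / 512 := by field_simp
        _ < _ := by
          have : 0 < ε ^ 3 := by positivity
          linarith
    · have : min (ε ^ 3 / 512 / √n) (min (lam / 4 / ρ₀) (θ₀ / ρ₀)) ≤ lam / 4 / ρ₀ :=
        (min_le_right _ _).trans (min_le_left _ _)
      rw [le_div_iff₀ hρ₀] at this
      linarith
    · have : min (ε ^ 3 / 512 / √n) (min (lam / 4 / ρ₀) (θ₀ / ρ₀)) ≤ θ₀ / ρ₀ :=
        (min_le_right _ _).trans (min_le_right _ _)
      rwa [le_div_iff₀ hρ₀] at this
  have hε3 : ε ^ 3 ≤ ε := by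
    calc ε ^ 3 = ε * ε ^ 2 := by ring
      _ ≤ ε * 1 := by gcongr; exact pow_le_one₀ hε.le hε1
      _ = ε := mul_one ε
  have hθε : √n * θ < ε / 4 := by linarith
  have hθε' : θ < ε / 4 := by nlinarith
  obtain ⟨B, hB, hBp⟩ := hbase (θ * ρ₀) (by positivity) hθ3
  obtain ⟨k, hk⟩ := exists_nat_ge (4 * ε⁻¹ / θ)
  rw [div_le_iff₀ hθ] at hk
  set H := hopCost n M with hH
  have hHtop : H < ⊤ := ENNReal.mul_lt_top (by finiteness) hMtop
  set C₁ : ℝ≥0∞ := k * H + ENNReal.ofReal 2 ^ n * M with hC₁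
  have hC₁top : C₁ < ⊤ := ENNReal.add_lt_top.2
    ⟨ENNReal.mul_lt_top (by simp) hHtop, ENNReal.mul_lt_top (by finiteness) hMtop⟩
  have key : ∀ j : ℕ, ∀ p ∈ Ω,
      ENNReal.ofReal (ε / 4 * (ρ₀ / 2 ^ j)) ≤ Metric.infEDist p (frontier Ω) →
      absAvg f (cube p (θ * (ρ₀ / 2 ^ j))) ≤ B + j * C₁ := by
    intro j
    induction j with
    | zero =>
      intro p hp hd
      simp only [pow_zero, div_one] at hd ⊢
      simpa using hBp p hp hd
    | succ j ih =>
      intro p hp hd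
      set ρ := ρ₀ / 2 ^ j with hρ
      have hρpos : 0 < ρ := by positivity
      have hρle : ρ ≤ ρ₀ := div_le_self hρ₀.le (one_le_pow₀ one_le_two)
      have hρ' : ρ₀ / 2 ^ (j + 1) = ρ / 2 := by rw [hρ, pow_succ]; field_simp
      rw [hρ'] at hd ⊢
      obtain ⟨q, hq, hpq, hdq⟩ := exists_corkscrew hε hΩ ha hb hρpos (by linarith)
        (by linarith) hp
      have hθρ : θ * ρ ≤ θ * ρ₀ := by gcongr
      have hθρ0 : 0 < θ * ρ := by positivity
      have h1 : absAvg f (cube p (θ * (ρ / 2))) ≤ absAvg f (cube q (θ * (ρ / 2))) + k * H := by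
        refine absAvg_le_of_far_from_frontier hε hε1 hΩ hf hq hp (a := ε / 4 * (ρ / 2)) (b := ρ)
          (by positivity) (by nlinarith) (by rwa [dist_comm]) (by rw [dist_comm]; linarith)
          ((ENNReal.ofReal_le_ofReal ?_).trans hdq) hd (by positivity) (by linarith) ?_ ?_
        · gcongr; linarith
        · calc √n * (θ * (ρ / 2)) = √n * θ * (ρ / 2) := by ring
            _ < ε ^ 3 / 256 * (ρ / 2) := by gcongr
            _ ≤ ε ^ 3 / 256 * ρ := by gcongr; linarith
            _ = _ := by field_simp; ring
        · nlinarith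
      have hsub : cube q (θ * ρ) ⊆ Ω := by
        refine cube_subset_of_le_infEDist hΩ.isOpen hq hθρ0.le hdq ?_
        have : √n * θ * ρ < ε / 4 * ρ := by gcongr
        nlinarith
      have h2 : absAvg f (cube q (θ * (ρ / 2))) ≤
          absAvg f (cube q (θ * ρ)) + ENNReal.ofReal 2 ^ n * M := by
        refine (absAvg_cube_le_of_superset (by positivity) (cube_mono (by nlinarith)) (A := 2)
          (by linarith) (hf.1 _ _ hθρ0 hsub)).trans ?_
        gcongr
        exact meanOsc_le_bmoNorm f hθρ0 (by linarith) hsub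
      calc _ ≤ absAvg f (cube q (θ * ρ)) + ENNReal.ofReal 2 ^ n * M + k * H :=
            h1.trans (by gcongr)
        _ ≤ B + j * C₁ + ENNReal.ofReal 2 ^ n * M + k * H := by
            gcongr
            exact ih q hq hdq
        _ = B + (j + 1 : ℕ) * C₁ := by
            rw [hC₁]; push_cast; ring
  set K := ε / 4 * ρ₀ with hK
  have hKpos : 0 < K := by positivity
  set A := (4 * K + lam) / (θ * ρ₀) with hA
  set L := 2 * (|Real.log (4 * K + lam)| + 1) with hL
  set C : ℝ≥0∞ := B + ENNReal.ofReal L * C₁ + (1 + ENNReal.ofReal A ^ n) * M + M with hC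
  have hCtop : C ≠ ⊤ := by
    have := hMtop.ne
    have := hC₁top.ne
    have := hB.ne
    finiteness
  refine ⟨C.toNNReal, fun c l hl hsub => ?_⟩
  rw [ENNReal.coe_toNNReal hCtop]
  have hΛ := one_le_logWeight hl
  have hΛ' : 1 ≤ ENNReal.ofReal (logWeight l) := by simpa using hΛ
  by_cases hll : lam ≤ l
  · calc absAvg f (cube c l) ≤ M := absAvg_le_bmoNorm f hl hll hsub
      _ ≤ C := by rw [hC]; exact le_add_self
      _ ≤ _ := le_mul_of_one_le_right' hΛ'
  push Not at hll
  -- the first scale at which the center of the cube is as far from the boundary as `key` asks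
  obtain ⟨j, hj1, hj2⟩ : ∃ j : ℕ, K ≤ 2 ^ j * (l / 2) ∧ 2 ^ j * l ≤ 4 * K + lam := by
    by_cases h : K ≤ l / 2
    · exact ⟨0, by simpa using h, by simp; linarith⟩
    · push Not at h
      obtain ⟨m, hm1, hm2⟩ := exists_nat_pow_near (x := 2 * K / l) (y := 2)
        (by rw [le_div_iff₀ hl]; linarith) one_lt_two
      rw [le_div_iff₀ hl] at hm1
      rw [div_lt_iff₀ hl] at hm2
      exact ⟨m + 1, by linarith, by rw [pow_succ]; linarith⟩
  have hc : c ∈ Ω := hsub (center_mem_cube hl.le)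
  have hdc : ENNReal.ofReal (ε / 4 * (ρ₀ / 2 ^ j)) ≤ Metric.infEDist c (frontier Ω) := by
    refine (ENNReal.ofReal_le_ofReal ?_).trans
      (ofReal_le_infEDist_frontier hΩ.isOpen hsub (center_mem_cube (l := 0) le_rfl))
    rw [sub_zero, mul_div_assoc', div_le_iff₀ (by positivity)]
    linarith
  have h1 := key j c hc hdc
  have hθρ : 0 < θ * (ρ₀ / 2 ^ j) := by positivity
  have hθl : θ * (ρ₀ / 2 ^ j) ≤ l := by
    rw [mul_div_assoc', div_le_iff₀ (by positivity)]
    have : θ * ρ₀ ≤ ε / 4 * ρ₀ := by gcongr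
    have : 0 < 2 ^ j * l := by positivity
    nlinarith
  have h2 := absAvg_cube_le_of_subset hθρ hl (cube_mono (c := c) hθl) (A := A) (by
    rw [hA, mul_div_assoc', div_mul_div_comm, le_div_iff₀ (by positivity)]
    have : 0 < θ * ρ₀ := by positivity
    nlinarith) (hf.1 c l hl hsub)
  have hjL : (j : ℝ≥0∞) ≤ ENNReal.ofReal (L * logWeight l) := by
    rw [← ENNReal.ofReal_natCast]
    apply ENNReal.ofReal_le_ofReal
    have h3 : Real.log (2 ^ j * l) ≤ Real.log (4 * K + lam) :=
      Real.log_le_log (by positivity) hj2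
    rw [Real.log_mul (by positivity) hl.ne', Real.log_pow] at h3
    have h4 := neg_log_le_logWeight hl
    have h5 := le_abs_self (Real.log (4 * K + lam))
    have h6 := Real.log_two_gt_d9
    have h7 : (0 : ℝ) ≤ j := by positivity
    have h8 : 0 ≤ |Real.log (4 * K + lam)| := abs_nonneg _
    have h9 : (j : ℝ) * (1 / 2) ≤ j * Real.log 2 := by gcongr; linarith
    rw [hL]
    nlinarith
  calc absAvg f (cube c l) ≤ B + j * C₁ + (1 + ENNReal.ofReal A ^ n) * M := by
        refine h2.trans ?_
        gcongr
        exact meanOsc_le_bmoNorm f hl hll hsub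
    _ ≤ B * ENNReal.ofReal (logWeight l) + ENNReal.ofReal (L * logWeight l) * C₁ +
        (1 + ENNReal.ofReal A ^ n) * M * ENNReal.ofReal (logWeight l) := by
        refine add_le_add (add_le_add (le_mul_of_one_le_right' hΛ') (by gcongr))
          (le_mul_of_one_le_right' hΛ')
    _ = (B + ENNReal.ofReal L * C₁ + (1 + ENNReal.ofReal A ^ n) * M) *
        ENNReal.ofReal (logWeight l) := by
        rw [ENNReal.ofReal_mul (by positivity)]; ring
    _ ≤ _ := by
        gcongr
        rw [hC]
        exact le_self_add

/-! ### Truncated distance to the boundary -/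

/-- The distance to the boundary of `Ω`, truncated at `1`. -/
def bdryDist (Ω : Set (Eucl n)) (x : Eucl n) : ℝ := (min (Metric.infEDist x (frontier Ω)) 1).toReal

lemma bdryDist_nonneg (Ω : Set (Eucl n)) (x : Eucl n) : 0 ≤ bdryDist Ω x := ENNReal.toReal_nonneg

lemma bdryDist_le_one (Ω : Set (Eucl n)) (x : Eucl n) : bdryDist Ω x ≤ 1 := by
  have := ENNReal.toReal_mono ENNReal.one_ne_top
    (min_le_right (Metric.infEDist x (frontier Ω)) 1)
  simpa [bdryDist] using this

lemma ofReal_bdryDist (Ω : Set (Eucl n)) (x : Eucl n) :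
    ENNReal.ofReal (bdryDist Ω x) = min (Metric.infEDist x (frontier Ω)) 1 :=
  ENNReal.ofReal_toReal (ne_top_of_le_ne_top ENNReal.one_ne_top (min_le_right _ _))

lemma ofReal_le_infEDist_of_le_bdryDist {Ω : Set (Eucl n)} {x : Eucl n} {a : ℝ}
    (h : a ≤ bdryDist Ω x) : ENNReal.ofReal a ≤ Metric.infEDist x (frontier Ω) := by
  refine (ENNReal.ofReal_le_ofReal h).trans ?_
  rw [ofReal_bdryDist]
  exact min_le_left _ _

lemma min_le_bdryDist {Ω : Set (Eucl n)} {x : Eucl n} {a : ℝ}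
    (h : ENNReal.ofReal a ≤ Metric.infEDist x (frontier Ω)) : min a 1 ≤ bdryDist Ω x := by
  rw [← ENNReal.ofReal_le_ofReal_iff (bdryDist_nonneg _ _), ofReal_bdryDist, ENNReal.ofReal_min]
  exact min_le_min h (by simp)

lemma bdryDist_le_add_dist (Ω : Set (Eucl n)) (x y : Eucl n) :
    bdryDist Ω x ≤ bdryDist Ω y + dist x y := by
  rw [← ENNReal.ofReal_le_ofReal_iff (add_nonneg (bdryDist_nonneg _ _) dist_nonneg),
    ENNReal.ofReal_add (bdryDist_nonneg _ _) dist_nonneg, ofReal_bdryDist, ofReal_bdryDist,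
    ← edist_dist, ← min_add_add_right]
  exact min_le_min Metric.infEDist_le_infEDist_add_edist le_self_add

lemma continuous_bdryDist (Ω : Set (Eucl n)) : Continuous (bdryDist Ω) := by
  have : LipschitzWith 1 (bdryDist Ω) := LipschitzWith.of_le_add_mul 1 fun x y => by
    simpa using bdryDist_le_add_dist Ω x y
  exact this.continuous

lemma bdryDist_pos {Ω : Set (Eucl n)} (hΩ : IsOpen Ω) {x : Eucl n} (hx : x ∈ Ω) :
    0 < bdryDist Ω x := by
  obtain ⟨r, hr, h⟩ := exists_pos_ofReal_le_infEDist hΩ hx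
  exact (lt_min hr one_pos).trans_le (min_le_bdryDist h)

/-! ### Dyadic shells of a cube -/

/-- The number of the concentric cubes `(1 - 2⁻ᵏ) Q`, `k ∈ ℕ`, of `Q = cube c l` which do not
contain `x`. Inside `Q` it differs from `log₂ (l / dist (x, ∂Q))` by a bounded amount, but it is
easy to integrate. -/
def shellCount (c : Eucl n) (l : ℝ) (x : Eucl n) : ℝ≥0∞ :=
  ∑' k : ℕ, (cube c ((1 - (1 / 2) ^ k) * l))ᶜ.indicator 1 x

lemma measurable_shellCount (c : Eucl n) (l : ℝ) : Measurable (shellCount c l) :=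
  Measurable.tsum fun _ => measurable_one.indicator (measurableSet_cube _ _).compl

lemma volume_cube_sdiff_le (c : Eucl n) {l θ : ℝ} (hl : 0 < l) (h0 : 0 ≤ θ) (h1 : θ ≤ 1) :
    volume ((cube c ((1 - θ) * l))ᶜ ∩ cube c l) ≤ ENNReal.ofReal (n * θ) * volume (cube c l) := by
  rw [inter_comm, ← sdiff_eq, measure_sdiff (cube_mono (by nlinarith))
    (measurableSet_cube _ _).nullMeasurableSet (volume_cube_ne_top _ _), volume_cube, volume_cube,
    ← ENNReal.ofReal_pow hl.le, ← ENNReal.ofReal_pow (by nlinarith), tsub_le_iff_right,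
    ← ENNReal.ofReal_mul (by positivity), ← ENNReal.ofReal_add (by positivity)
      (pow_nonneg (by nlinarith) _)]
  apply ENNReal.ofReal_le_ofReal
  have h2 : 1 + (n : ℝ) * (-θ) ≤ (1 + -θ) ^ n := one_add_mul_le_pow (by linarith) n
  have h3 : 0 < l ^ n := by positivity
  rw [mul_pow, ← add_mul]
  rw [← sub_eq_add_neg] at h2
  nlinarith

lemma laverage_shellCount_le (c : Eucl n) {l : ℝ} (hl : 0 < l) :
    ⨍⁻ x in cube c l, shellCount c l x ∂volume ≤ 2 * n := by
  rw [setLAverage_eq]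
  refine ENNReal.div_le_of_le_mul ?_
  unfold shellCount
  rw [lintegral_tsum fun k =>
    (measurable_one.indicator (measurableSet_cube _ _).compl).aemeasurable]
  calc ∑' k : ℕ, ∫⁻ x in cube c l, (cube c ((1 - (1 / 2) ^ k) * l))ᶜ.indicator 1 x
      ≤ ∑' k : ℕ, ENNReal.ofReal ((1 / 2) ^ k) * (n * volume (cube c l)) := by
        refine ENNReal.tsum_le_tsum fun k => ?_
        rw [setLIntegral_indicator (measurableSet_cube _ _).compl]
        simp only [Pi.one_apply, lintegral_const, MeasurableSet.univ, Measure.restrict_apply,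
          univ_inter, one_mul]
        refine (volume_cube_sdiff_le c hl (by positivity)
          (pow_le_one₀ (by norm_num) (by norm_num))).trans_eq ?_
        rw [ENNReal.ofReal_mul (by positivity), ENNReal.ofReal_natCast]
        ring
    _ = 2 * n * volume (cube c l) := by
        rw [ENNReal.tsum_mul_right, ← ENNReal.ofReal_tsum_of_nonneg (fun k => by positivity)
          summable_geometric_two, tsum_geometric_two, ENNReal.ofReal_ofNat, mul_assoc]

lemma exists_mem_cube_of_shellCount {c x : Eucl n} {l : ℝ} (h : shellCount c l x ≠ ⊤) :
    ∃ J : ℕ, x ∈ cube c ((1 - (1 / 2) ^ J) * l) ∧ (J : ℝ≥0∞) ≤ shellCount c l x := by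
  classical
  have hex : ∃ J : ℕ, x ∈ cube c ((1 - (1 / 2) ^ J) * l) := by
    by_contra! hno
    refine h ?_
    have : shellCount c l x = ∑' _ : ℕ, (1 : ℝ≥0∞) :=
      tsum_congr fun k => indicator_of_mem (hno k) _
    rw [this]
    exact ENNReal.tsum_const_eq_top_of_ne_zero one_ne_zero
  refine ⟨Nat.find hex, Nat.find_spec hex, ?_⟩
  calc ((Nat.find hex : ℕ) : ℝ≥0∞)
      = ∑ k ∈ Finset.range (Nat.find hex), (cube c ((1 - (1 / 2) ^ k) * l))ᶜ.indicator 1 x := by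
        rw [Finset.sum_congr rfl (g := fun _ => 1)]
        · simp
        · intro k hk
          exact indicator_of_mem (Nat.find_min hex (Finset.mem_range.1 hk)) _
    _ ≤ _ := ENNReal.sum_le_tsum _

/-! ### The double logarithm of the distance to the boundary -/

/-- The function `log (1 + log (1 / d))`, where `d` is the truncated distance to the boundary. -/
def logLogDist (Ω : Set (Eucl n)) (x : Eucl n) : ℝ := Real.log (logWeight (bdryDist Ω x))

lemma measurable_logLogDist (Ω : Set (Eucl n)) : Measurable (logLogDist Ω) := by
  unfold logLogDist logWeight
  exact Real.measurable_log.comp (measurable_const.sub (Real.measurable_log.comp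
    ((continuous_bdryDist Ω).measurable.min measurable_const)))

lemma abs_log_logWeight_sub_le {m D : ℝ} (hm : 0 < m) (hmD : m ≤ D) (hD : D ≤ 1) :
    |Real.log (logWeight m) - Real.log (logWeight D)| ≤ Real.log (D / m) / logWeight D := by
  have hD0 := hm.trans_le hmD
  have h1 := logWeight_pos hD0
  have h2 := logWeight_pos hm
  have h3 := logWeight_anti hm hmD
  rw [abs_of_nonneg (sub_nonneg.2 (Real.log_le_log h1 h3)), ← Real.log_div h2.ne' h1.ne']
  refine (Real.log_le_sub_one_of_pos (by positivity)).trans_eq ?_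
  rw [Real.log_div hD0.ne' hm.ne', div_sub_one h1.ne']
  congr 1
  unfold logWeight
  rw [min_eq_left hD, min_eq_left (hmD.trans hD)]
  ring

/-- A bound, depending only on the dimension, for the oscillation of `logLogDist` over a cube of
side `l`, multiplied by `logWeight l`. -/
def logLogConst (n : ℕ) : ℝ≥0∞ :=
  ENNReal.ofReal (1 + Real.log (4 * √n)) * (ENNReal.ofReal (Real.log (8 * √n)) + 2 * n) +
    ENNReal.ofReal (4 / 3 * √n)

lemma logLogConst_lt_top (n : ℕ) : logLogConst n < ⊤ := by
  unfold logLogConst; finiteness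

/-- On a cube `Q` of side `l` near the boundary, `log (1 / d)` has bounded mean oscillation, so its
logarithm oscillates by `O(1 / log (1 / l))`; on a cube of side `l ≪ d` the oscillation is
`O(l / d)` divided by `log (1 / d)`. -/
lemma exists_logWeight_mul_laverage_le (hn : 1 ≤ n) {Ω : Set (Eucl n)} (hΩ : IsOpen Ω) {c : Eucl n}
    {l : ℝ} (hl : 0 < l) (hsub : cube c l ⊆ Ω) :
    ∃ a : ℝ, ENNReal.ofReal (logWeight l) * ⨍⁻ x in cube c l, ‖logLogDist Ω x - a‖ₑ ∂volume ≤
      logLogConst n := by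
  have hn1 : (1 : ℝ) ≤ √n := by
    rw [Real.one_le_sqrt]; exact_mod_cast hn
  set D := min 1 (bdryDist Ω c + √n * (l / 2)) with hD
  have hcΩ : c ∈ Ω := hsub (center_mem_cube hl.le)
  have hD1 : D ≤ 1 := min_le_left _ _
  have hD0 : 0 < D :=
    lt_min one_pos (add_pos_of_pos_of_nonneg (bdryDist_pos hΩ hcΩ) (by positivity))
  have hmD : ∀ x ∈ cube c l, bdryDist Ω x ≤ D := fun x hx => le_min (bdryDist_le_one _ _)
    ((bdryDist_le_add_dist Ω x c).trans (by gcongr; exact dist_le_of_mem_cube hl.le hx))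
  have hm0 : ∀ x ∈ cube c l, 0 < bdryDist Ω x := fun x hx => bdryDist_pos hΩ (hsub hx)
  have hΛl := logWeight_pos hl
  have hΛD := one_le_logWeight hD0
  refine ⟨Real.log (logWeight D), ?_⟩
  set A := 1 + Real.log (4 * √n) with hA
  set B := Real.log (8 * √n) with hB
  have hA1 : 1 ≤ A := by
    have := Real.log_nonneg (show 1 ≤ 4 * √(n : ℝ) by linarith)
    linarith
  have hB0 : 0 ≤ B := Real.log_nonneg (by linarith)
  have hpt : ∀ x ∈ cube c l, ENNReal.ofReal (logWeight l) *
      ‖logLogDist Ω x - Real.log (logWeight D)‖ₑ ≤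
      ENNReal.ofReal A * (ENNReal.ofReal B + shellCount c l x) + ENNReal.ofReal (4 / 3 * √n) := by
    intro x hx
    have hm := hm0 x hx
    have h1 := abs_log_logWeight_sub_le hm (hmD x hx) hD1
    have hlog0 : 0 ≤ Real.log (D / bdryDist Ω x) :=
      Real.log_nonneg (by rw [le_div_iff₀ hm, one_mul]; exact hmD x hx)
    rw [Real.enorm_eq_ofReal_abs, ← ENNReal.ofReal_mul hΛl.le]
    have h2 : logWeight l * |logLogDist Ω x - Real.log (logWeight D)| ≤
        logWeight l / logWeight D * Real.log (D / bdryDist Ω x) := by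
      calc _ ≤ logWeight l * (Real.log (D / bdryDist Ω x) / logWeight D) := by
            gcongr
            exact h1
        _ = _ := by ring
    refine (ENNReal.ofReal_le_ofReal h2).trans ?_
    by_cases hcase : D ≤ 4 * √n * l
    · -- the cube is not small compared to its distance to the boundary
      refine le_trans ?_ le_self_add
      by_cases htop : shellCount c l x = ⊤
      · rw [htop, add_top, ENNReal.mul_top (by simpa using by linarith)]
        exact le_top
      obtain ⟨J, hxJ, hJ⟩ := exists_mem_cube_of_shellCount htop
      have hratio : logWeight l / logWeight D ≤ A := by
        rw [div_le_iff₀ (by linarith)]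
        have h3 : logWeight l ≤ logWeight D + Real.log (4 * √n) := by
          have h4 : D ≤ 4 * √n * min l 1 := by
            rcases min_choice l 1 with h | h <;> rw [h]
            · exact hcase
            · linarith
          have h5 := Real.log_le_log hD0 h4
          rw [Real.log_mul (by positivity) (lt_min hl one_pos).ne'] at h5
          have h6 : logWeight D = 1 - Real.log D := by unfold logWeight; rw [min_eq_left hD1]
          have h7 : logWeight l = 1 - Real.log (min l 1) := rfl
          linarith
        rw [hA] at hA1 ⊢
        nlinarith
      have hm' : D / bdryDist Ω x ≤ 8 * √n * 2 ^ J := by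
        rw [div_le_iff₀ hm]
        have h3 := min_le_bdryDist (ofReal_le_infEDist_frontier hΩ hsub hxJ)
        have h4 : (l - (1 - (1 / 2 : ℝ) ^ J) * l) / 2 = l / 2 / 2 ^ J := by
          rw [one_div, inv_pow]; field_simp; ring
        rw [h4] at h3
        have h5 : (1 : ℝ) ≤ 2 ^ J := one_le_pow₀ one_le_two
        refine le_trans ?_ (mul_le_mul_of_nonneg_left h3 (by positivity))
        rcases min_choice (l / 2 / 2 ^ J) 1 with h | h <;> rw [h]
        · calc D ≤ 4 * √n * l := hcase
            _ = _ := by field_simp; ring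
        · have : 1 * 1 ≤ √(n : ℝ) * 2 ^ J := by gcongr
          nlinarith
      have hlogle : Real.log (D / bdryDist Ω x) ≤ B + J := by
        refine (Real.log_le_log (by positivity) hm').trans ?_
        rw [Real.log_mul (by positivity) (by positivity), Real.log_pow]
        have : (J : ℝ) * Real.log 2 ≤ J * 1 := by
          gcongr
          linarith [Real.log_two_lt_d9]
        linarith
      calc ENNReal.ofReal (logWeight l / logWeight D * Real.log (D / bdryDist Ω x))
          ≤ ENNReal.ofReal (A * (B + J)) := by
            apply ENNReal.ofReal_le_ofReal
            gcongr
        _ = ENNReal.ofReal A * (ENNReal.ofReal B + J) := by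
            rw [ENNReal.ofReal_mul (by linarith), ENNReal.ofReal_add hB0 (by positivity),
              ENNReal.ofReal_natCast]
        _ ≤ _ := by gcongr
    · -- the distance to the boundary is nearly constant on the cube
      push Not at hcase
      refine le_trans (ENNReal.ofReal_le_ofReal ?_) le_add_self
      have hl1 : l < 1 := by nlinarith
      have hlD : l ≤ D := by nlinarith
      have hratio : logWeight l / logWeight D ≤ D / l := by
        rw [div_le_iff₀ (by linarith)]
        have h3 := Real.log_le_sub_one_of_pos (show 0 < D / l by positivity)
        rw [Real.log_div hD0.ne' hl.ne'] at h3
        have h4 : logWeight D = 1 - Real.log D := by unfold logWeight; rw [min_eq_left hD1]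
        have h5 : logWeight l = 1 - Real.log l := by unfold logWeight; rw [min_eq_left hl1.le]
        have h6 : 1 ≤ D / l := by rw [le_div_iff₀ hl]; linarith
        nlinarith
      have h7 : D - √n * l ≤ bdryDist Ω x := by
        have h8 : D ≤ bdryDist Ω c + √n * (l / 2) := min_le_right _ _
        have h9 := bdryDist_le_add_dist Ω c x
        rw [dist_comm] at h9
        have h10 := dist_le_of_mem_cube hl.le hx
        linarith
      have h8 : 3 / 4 * D ≤ bdryDist Ω x := by linarith
      have h9 : Real.log (D / bdryDist Ω x) ≤ 4 / 3 * √n * l / D := by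
        refine (Real.log_le_sub_one_of_pos (by positivity)).trans ?_
        rw [div_sub_one hm.ne', div_le_div_iff₀ hm hD0]
        calc (D - bdryDist Ω x) * D ≤ √n * l * D := by gcongr; linarith
          _ = 4 / 3 * √n * l * (3 / 4 * D) := by ring
          _ ≤ _ := by gcongr
      calc logWeight l / logWeight D * Real.log (D / bdryDist Ω x)
          ≤ D / l * (4 / 3 * √n * l / D) := by gcongr
        _ = 4 / 3 * √n := by field_simp
  rw [← setLAverage_const_mul ENNReal.ofReal_ne_top]
  refine (setLAverage_mono_on (measurableSet_cube _ _) hpt).trans ?_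
  have hQ0 := volume_cube_ne_zero c hl
  have hQ := volume_cube_ne_top c l
  have hms : Measurable fun x => ENNReal.ofReal B + shellCount c l x :=
    (measurable_shellCount c l).const_add _
  refine (setLAverage_add (hms.const_mul (ENNReal.ofReal A)).aemeasurable).trans_le ?_
  rw [setLAverage_const_mul ENNReal.ofReal_ne_top, setLAverage_const hQ0 hQ,
    setLAverage_add aemeasurable_const, setLAverage_const hQ0 hQ]
  unfold logLogConst
  gcongr
  exact laverage_shellCount_le c hl

/-! ### Cutting off near the boundary -/

/-- The cutoff function with slope `κ` in `logLogDist`, equal to `1` where `logLogDist Ω x ≤ b`. -/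
def bdryCutoff (Ω : Set (Eucl n)) (κ b : ℝ) (x : Eucl n) : ℝ :=
  max 0 (min 1 (1 - κ * (logLogDist Ω x - b)))

lemma abs_max_min_sub_le (s t : ℝ) : |max 0 (min 1 s) - max 0 (min 1 t)| ≤ |s - t| := by
  have h1 := abs_max_sub_max_le_abs (min 1 s) (min 1 t) 0
  have h2 := abs_min_sub_min_le_max 1 s 1 t
  rw [max_comm 0, max_comm 0]
  simpa using h1.trans h2

lemma exists_pos_mul_ofReal_le {X η : ℝ≥0∞} (hX : X < ⊤) (hη : 0 < η) :
    ∃ κ : ℝ, 0 < κ ∧ κ ≤ 1 ∧ X * ENNReal.ofReal κ ≤ η := by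
  have h : Tendsto (fun κ : ℝ => X * ENNReal.ofReal κ) (𝓝[>] 0) (𝓝 0) := by
    have h1 : Tendsto (fun κ : ℝ => X * ENNReal.ofReal κ) (𝓝 0) (𝓝 (X * ENNReal.ofReal 0)) :=
      ENNReal.Tendsto.const_mul (ENNReal.continuous_ofReal.tendsto 0) (Or.inr hX.ne)
    simp only [ENNReal.ofReal_zero, mul_zero] at h1
    exact h1.mono_left nhdsWithin_le_nhds
  obtain ⟨κ, h1, h2⟩ := ((h.eventually (gt_mem_nhds hη)).and
    (Ioc_mem_nhdsGT (one_pos : (0 : ℝ) < 1))).exists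
  exact ⟨κ, h2.1, h2.2, h1.le⟩

lemma exists_pos_mul_logWeight_le {κ t : ℝ} (hκ : 0 < κ) (ht : 0 < t) :
    ∃ s : ℝ, 0 < s ∧ s ≤ t ∧ s ≤ 1 ∧ ∀ l, 0 < l → l ≤ s → l * logWeight l ≤ κ := by
  have h : Tendsto (fun s : ℝ => s - s * Real.log s) (𝓝[>] 0) (𝓝 0) := by
    have h1 : Continuous fun s : ℝ => s - s * Real.log s :=
      continuous_id.sub Real.continuous_mul_log
    have h2 := h1.tendsto 0
    simp only [zero_mul, sub_zero] at h2
    exact h2.mono_left nhdsWithin_le_nhds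
  obtain ⟨u, hu, h1⟩ := mem_nhdsGT_iff_exists_Ioc_subset.1 (h.eventually (gt_mem_nhds hκ))
  refine ⟨min u (min t 1), lt_min hu (lt_min ht one_pos),
    (min_le_right _ _).trans (min_le_left _ _),
    (min_le_right _ _).trans (min_le_right _ _), fun l hl hls => ?_⟩
  have h2 : l - l * Real.log l < κ := h1 ⟨hl, hls.trans (min_le_left _ _)⟩
  unfold logWeight
  rw [min_eq_left (hls.trans ((min_le_right _ _).trans (min_le_right _ _)))]
  linarith

lemma exists_modulus_le {Ω : Set (Eucl n)} {f : Eucl n → ℝ} (h : VanishingMeanOsc Ω f) {η : ℝ≥0∞}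
    (hη : 0 < η) {T : ℝ} (hT : 0 < T) : ∃ t, 0 < t ∧ t ≤ T ∧ modulus Ω f t ≤ η := by
  obtain ⟨t, h1, h2⟩ := ((h.eventually (gt_mem_nhds hη)).and (Ioc_mem_nhdsGT hT)).exists
  exact ⟨t, h2.1, h2.2, h1.le⟩

lemma integrableOn_mul_of_bounded {Q : Set (Eucl n)} {f φ : Eucl n → ℝ}
    (hf : IntegrableOn f Q) (hφ : Measurable φ) (hb : ∀ x, |φ x| ≤ 1) :
    IntegrableOn (f * φ) Q := by
  have := Integrable.bdd_mul (c := 1) hf hφ.aestronglyMeasurable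
    (Eventually.of_forall fun x => by simpa using hb x)
  refine this.congr (Eventually.of_forall fun x => mul_comm _ _)

/-- A function of vanishing mean oscillation can be cut off near the boundary at a small cost, as
soon as its averages grow at most logarithmically. -/
lemma exists_boundary_cutoff (hn : 1 ≤ n) {Ω : Set (Eucl n)} (hΩ : IsOpen Ω) {f : Eucl n → ℝ}
    (hf : ∀ (c : Eucl n) (l : ℝ), 0 < l → cube c l ⊆ Ω → IntegrableOn f (cube c l)) {C : ℝ≥0}
    (hC : ∀ c l, 0 < l → cube c l ⊆ Ω →
      absAvg f (cube c l) ≤ C * ENNReal.ofReal (logWeight l))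
    (hvmo : VanishingMeanOsc Ω f) {lam : ℝ} (hlam : 0 < lam) {η : ℝ≥0∞} (hη : 0 < η) :
    ∃ φ : Eucl n → ℝ, Measurable φ ∧ (∀ x, 0 ≤ φ x ∧ φ x ≤ 1) ∧
      (∃ s > 0, ∀ x ∈ Ω, bdryDist Ω x ≤ s → φ x = 0) ∧
      ∃ t > 0, t ≤ lam ∧
        (∀ c l, 0 < l → l < t → cube c l ⊆ Ω →
          meanOsc (f * φ) (cube c l) ≤ η ∧ meanOsc (f - f * φ) (cube c l) ≤ η) ∧
        (∀ c l, t ≤ l → cube c l ⊆ Ω → absAvg (f - f * φ) (cube c l) ≤ η) := by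
  have h8 : 0 < η / 8 := ENNReal.div_pos hη.ne' (by simp)
  obtain ⟨t, ht0, htl, ht⟩ := exists_modulus_le hvmo h8 hlam
  obtain ⟨κ, hκ0, -, hκ⟩ := exists_pos_mul_ofReal_le
    (X := C * logLogConst n) (ENNReal.mul_lt_top (by simp) (logLogConst_lt_top n)) h8
  obtain ⟨κ', hκ'0, -, hκ'⟩ := exists_pos_mul_ofReal_le
    (X := C * ENNReal.ofReal (4 * n / t)) (ENNReal.mul_lt_top (by simp) (by simp)) hη
  obtain ⟨s, hs0, hst, hs1, hs⟩ := exists_pos_mul_logWeight_le hκ'0 (t := t / 4) (by positivity)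
  set b := Real.log (logWeight s) with hb
  set φ := bdryCutoff Ω κ b with hφ
  have hφm : Measurable φ := measurable_const.max (measurable_const.min
    (measurable_const.sub (((measurable_logLogDist Ω).sub measurable_const).const_mul κ)))
  have hφ01 : ∀ x, 0 ≤ φ x ∧ φ x ≤ 1 := fun x =>
    ⟨le_max_left _ _, max_le zero_le_one (min_le_left _ _)⟩
  have hφabs : ∀ x, |φ x| ≤ 1 := fun x => abs_le.2 ⟨by linarith [(hφ01 x).1], (hφ01 x).2⟩
  have hfφ : ∀ (c : Eucl n) (l : ℝ), 0 < l → cube c l ⊆ Ω → IntegrableOn (f * φ) (cube c l) :=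
    fun c l hl hsub => integrableOn_mul_of_bounded (hf c l hl hsub) hφm hφabs
  -- `exp (1 - exp (b + 1 / κ))` is the distance at which `logLogDist` reaches `b + 1 / κ`
  refine ⟨φ, hφm, hφ01, ⟨Real.exp (1 - Real.exp (b + 1 / κ)), Real.exp_pos _, fun x hx hd => ?_⟩,
    t, ht0, htl, fun c l hl hlt hsub => ?_, fun c l htl hsub => ?_⟩
  · have hm := bdryDist_pos hΩ hx
    have h1 : Real.exp (b + 1 / κ) ≤ logWeight (bdryDist Ω x) := by
      unfold logWeight
      rw [min_eq_left (bdryDist_le_one _ _)]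
      have := Real.log_le_log hm hd
      rw [Real.log_exp] at this
      linarith
    have h2 : b + 1 / κ ≤ logLogDist Ω x := by
      have := Real.log_le_log (Real.exp_pos _) h1
      rwa [Real.log_exp] at this
    have h3 : 1 - κ * (logLogDist Ω x - b) ≤ 0 := by
      have : κ * (1 / κ) ≤ κ * (logLogDist Ω x - b) := by gcongr; linarith
      rw [mul_one_div_cancel hκ0.ne'] at this
      linarith
    exact max_eq_left ((min_le_right _ _).trans h3)
  · obtain ⟨a, ha⟩ := exists_logWeight_mul_laverage_le hn hΩ hl hsub
    have hosc : meanOsc f (cube c l) ≤ η / 8 := (meanOsc_le_modulus f hl hlt hsub).trans ht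
    have h1 : meanOsc (f * φ) (cube c l) ≤ η / 2 := by
      refine (meanOsc_mul_le (measurableSet_cube _ _) (hf c l hl hsub) (hfφ c l hl hsub)
        (fun x _ => hφabs x) (volume_cube_ne_zero c hl) (volume_cube_ne_top c l)
        (max 0 (min 1 (1 - κ * (a - b))))).trans ?_
      have h2 : ⨍⁻ x in cube c l, ‖φ x - max 0 (min 1 (1 - κ * (a - b)))‖ₑ ∂volume ≤
          ENNReal.ofReal κ * ⨍⁻ x in cube c l, ‖logLogDist Ω x - a‖ₑ ∂volume := by
        rw [← setLAverage_const_mul ENNReal.ofReal_ne_top]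
        refine setLAverage_mono_on (measurableSet_cube _ _) fun x _ => ?_
        rw [Real.enorm_eq_ofReal_abs, Real.enorm_eq_ofReal_abs, ← ENNReal.ofReal_mul hκ0.le]
        apply ENNReal.ofReal_le_ofReal
        refine (abs_max_min_sub_le _ _).trans_eq ?_
        have : 1 - κ * (logLogDist Ω x - b) - (1 - κ * (a - b)) = -(κ * (logLogDist Ω x - a)) := by
          ring
        rw [this, abs_neg, abs_mul, abs_of_pos hκ0]
      calc _ ≤ 2 * (η / 8 + C * ENNReal.ofReal (logWeight l) * (ENNReal.ofReal κ *
            ⨍⁻ x in cube c l, ‖logLogDist Ω x - a‖ₑ ∂volume)) := by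
            gcongr
            exact hC c l hl hsub
        _ = 2 * (η / 8 + C * ENNReal.ofReal κ * (ENNReal.ofReal (logWeight l) *
            ⨍⁻ x in cube c l, ‖logLogDist Ω x - a‖ₑ ∂volume)) := by ring
        _ ≤ 2 * (η / 8 + C * ENNReal.ofReal κ * logLogConst n) := by gcongr
        _ = 2 * (η / 8 + C * logLogConst n * ENNReal.ofReal κ) := by ring
        _ ≤ 2 * (η / 8 + η / 8) := by gcongr
        _ = 4 * (η / 8) := by ring
        _ = η / 2 := by
          rw [show (8 : ℝ≥0∞) = 4 * 2 by norm_num, ← mul_div_assoc,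
            ENNReal.mul_div_mul_left _ _ (by simp) (by simp)]
    refine ⟨h1.trans ENNReal.half_le_self, ?_⟩
    calc meanOsc (f - f * φ) (cube c l) ≤ meanOsc f (cube c l) + meanOsc (f * φ) (cube c l) :=
          meanOsc_sub_le (hf c l hl hsub) (hfφ c l hl hsub)
      _ ≤ η / 2 + η / 2 := by
          refine add_le_add (hosc.trans ?_) h1
          gcongr
          norm_num
      _ = η := ENNReal.add_halves η
  · have hl : 0 < l := ht0.trans_le htl
    -- a grid whose cells are slightly larger than the width `s` of the layer where `φ ≠ 1`
    set N := ⌊l / s⌋₊ with hN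
    have hls : 4 ≤ l / s := by rw [le_div_iff₀ hs0]; linarith
    have hN4 : 4 ≤ N := Nat.le_floor (by exact_mod_cast hls)
    have hN4' : (4 : ℝ) ≤ N := by exact_mod_cast hN4
    have hNle : (N : ℝ) ≤ l / s := Nat.floor_le (by positivity)
    have hNlt : l / s < N + 1 := Nat.lt_floor_add_one _
    have hsr : s ≤ l / N := by
      rw [le_div_iff₀ (by linarith)]
      rw [le_div_iff₀ hs0] at hNle
      linarith
    have hB : ∀ a, cube a (l / N) ⊆ cube c l →
        ⨍⁻ x in cube a (l / N), ‖f x‖ₑ ∂volume ≤ C * ENNReal.ofReal (logWeight s) := by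
      intro a ha
      refine (hC a (l / N) (hs0.trans_le hsr) (ha.trans hsub)).trans ?_
      gcongr
      exact logWeight_anti hs0 hsr
    have h1 := laverage_layer_le_of_grid hl (by omega) hB
    refine (setLAverage_mono_on (measurableSet_cube _ _) fun x hx => ?_).trans (h1.trans ?_)
    · have hxΩ := hsub hx
      by_cases hxl : x ∈ cube c (l - 2 * (l / N))
      · have h2 := min_le_bdryDist (ofReal_le_infEDist_frontier hΩ hsub hxl)
        have h3 : s ≤ bdryDist Ω x := by
          refine le_trans (le_min ?_ hs1) h2
          linarith
        have h4 : logLogDist Ω x ≤ b := Real.log_le_log (logWeight_pos (bdryDist_pos hΩ hxΩ))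
          (logWeight_anti hs0 h3)
        have h5 : φ x = 1 := by
          have : 1 ≤ 1 - κ * (logLogDist Ω x - b) := by nlinarith
          simp only [hφ, bdryCutoff, min_eq_left this]
          simp
        simp [h5]
      · rw [indicator_of_mem (by exact hxl)]
        have h2 : (f - f * φ) x = f x * (1 - φ x) := by simp; ring
        rw [h2, enorm_mul]
        refine mul_le_of_le_one_right' ?_
        rw [Real.enorm_eq_ofReal_abs, ENNReal.ofReal_le_one, abs_le]
        constructor <;> linarith [(hφ01 x).1, (hφ01 x).2]
    · refine le_trans ?_ hκ'
      calc ENNReal.ofReal (2 * n / N) * (C * ENNReal.ofReal (logWeight s))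
          = C * ENNReal.ofReal (2 * n / N * logWeight s) := by
            rw [ENNReal.ofReal_mul (by positivity)]; ring
        _ ≤ C * ENNReal.ofReal (4 * n / t * κ') := by
            gcongr C * ENNReal.ofReal ?_
            have hW := logWeight_pos hs0
            have h3 : t / (2 * s) ≤ N := by
              have : t / s ≤ l / s := by gcongr
              have h5 : t / (2 * s) = t / s / 2 := by field_simp
              rw [h5]; linarith
            calc 2 * n / N * logWeight s ≤ 2 * n / (t / (2 * s)) * logWeight s := by gcongr
              _ = 4 * n / t * (s * logWeight s) := by field_simp; ring
              _ ≤ _ := by gcongr; exact hs s hs0 le_rfl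
        _ = _ := by rw [ENNReal.ofReal_mul (by positivity)]; ring

/-! ### Mollification -/

/-- A smooth probability density supported in the ball of radius `τ` around the origin. -/
def mollifier (n : ℕ) {τ : ℝ} (hτ : 0 < τ) : Eucl n → ℝ :=
  (⟨τ / 2, τ, by positivity, by linarith⟩ : ContDiffBump (0 : Eucl n)).normed volume

lemma mollifier_nonneg {τ : ℝ} (hτ : 0 < τ) (x : Eucl n) : 0 ≤ mollifier n hτ x :=
  ContDiffBump.nonneg_normed _ x

lemma contDiff_mollifier {τ : ℝ} (hτ : 0 < τ) :
    ContDiff ℝ ((⊤ : ℕ∞) : WithTop ℕ∞) (mollifier n hτ) :=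
  ContDiffBump.contDiff_normed _

lemma hasCompactSupport_mollifier {τ : ℝ} (hτ : 0 < τ) : HasCompactSupport (mollifier n hτ) :=
  ContDiffBump.hasCompactSupport_normed _

lemma integral_mollifier {τ : ℝ} (hτ : 0 < τ) : ∫ x, mollifier n hτ x = 1 :=
  ContDiffBump.integral_normed _

lemma mollifier_eq_zero {τ : ℝ} (hτ : 0 < τ) {x : Eucl n} (hx : τ ≤ ‖x‖) :
    mollifier n hτ x = 0 := by
  rw [← Function.notMem_support, mollifier, ContDiffBump.support_normed_eq]
  simpa using hx

lemma mollifier_le (hn : 1 ≤ n) {τ : ℝ} (hτ : 0 < τ) (x : Eucl n) :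
    mollifier n hτ x ≤ (√n / τ) ^ n := by
  have hn0 : 0 < √(n : ℝ) := by
    have : (0 : ℝ) < n := by exact_mod_cast hn
    positivity
  refine (ContDiffBump.normed_le_div_measure_closedBall_rIn _ volume x).trans ?_
  have h1 : (τ / √n) ^ n ≤ volume.real (Metric.closedBall (0 : Eucl n) (τ / 2)) := by
    have h2 : cube (0 : Eucl n) (τ / √n) ⊆ Metric.closedBall 0 (τ / 2) := fun y hy => by
      have := dist_le_of_mem_cube (by positivity) hy
      refine this.trans_eq ?_
      field_simp
    have h3 := measure_mono (μ := volume) h2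
    rw [volume_cube, ← ENNReal.ofReal_pow (by positivity)] at h3
    exact (ENNReal.ofReal_le_iff_le_toReal Metric.isBounded_closedBall.measure_lt_top.ne).1 h3
  have h4 : (√n / τ) ^ n = 1 / (τ / √n) ^ n := by
    rw [← one_div_div τ, div_pow, one_pow]
  rw [h4]
  exact one_div_le_one_div_of_le (by positivity) h1

/-- The convolution of `G` with `mollifier n hτ`. -/
def mollify {τ : ℝ} (hτ : 0 < τ) (G : Eucl n → ℝ) (x : Eucl n) : ℝ :=
  ∫ y, mollifier n hτ (x - y) * G y

lemma mollify_eq_convolution {τ : ℝ} (hτ : 0 < τ) (G : Eucl n → ℝ) :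
    mollify hτ G = convolution (mollifier n hτ) G (ContinuousLinearMap.lsmul ℝ ℝ) volume := by
  ext x
  rw [convolution_eq_swap]
  rfl

lemma contDiff_mollify {τ : ℝ} (hτ : 0 < τ) {G : Eucl n → ℝ} (hG : LocallyIntegrable G) :
    ContDiff ℝ ((⊤ : ℕ∞) : WithTop ℕ∞) (mollify hτ G) := by
  rw [mollify_eq_convolution]
  exact (hasCompactSupport_mollifier hτ).contDiff_convolution_left _ (contDiff_mollifier hτ) hG

lemma integrable_mollifier_mul {τ : ℝ} (hτ : 0 < τ) {G : Eucl n → ℝ} (hG : LocallyIntegrable G)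
    (x : Eucl n) : Integrable fun y => mollifier n hτ (x - y) * G y :=
  ((hasCompactSupport_mollifier hτ).convolutionExists_left (ContinuousLinearMap.lsmul ℝ ℝ)
    (contDiff_mollifier hτ).continuous hG x).integrable_swap

lemma exists_ne_zero_of_mollify_ne_zero {τ : ℝ} (hτ : 0 < τ) {G : Eucl n → ℝ} {x : Eucl n}
    (h : mollify hτ G x ≠ 0) : ∃ y, dist x y < τ ∧ G y ≠ 0 := by
  by_contra! hno
  refine h ?_
  unfold mollify
  rw [integral_eq_zero_of_ae (Eventually.of_forall fun y => ?_)]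
  by_cases hy : dist x y < τ
  · simp [hno y hy]
  · rw [mollifier_eq_zero hτ (by rw [← dist_eq_norm]; exact not_lt.1 hy)]
    simp

lemma integrableOn_cube {G : Eucl n → ℝ} (hG : LocallyIntegrable G) (c : Eucl n) {l : ℝ}
    (hl : 0 ≤ l) : IntegrableOn G (cube c l) :=
  (hG.integrableOn_isCompact (isCompact_closedBall c (√n * (l / 2)))).mono_set
    fun _ hy => dist_le_of_mem_cube hl hy

/-- At the points of a cube of side `2 τ`, the mollification of `G` at scale `τ` is controlled by
averages of `G` over the cube of side `4 τ`. -/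
lemma enorm_mollify_sub_le (hn : 1 ≤ n) {τ : ℝ} (hτ : 0 < τ) {G : Eucl n → ℝ}
    (hG : LocallyIntegrable G) {b x : Eucl n} (hx : x ∈ cube b (2 * τ)) (a : ℝ) :
    ‖mollify hτ G x - a‖ₑ ≤
      ENNReal.ofReal (4 * √n) ^ n * ⨍⁻ y in cube b (4 * τ), ‖G y - a‖ₑ ∂volume := by
  have h1 : ∫ y, mollifier n hτ (x - y) * a = a := by
    rw [integral_mul_const, integral_sub_left_eq_self (mollifier n hτ) volume x,
      integral_mollifier, one_mul]
  have h2 : mollify hτ G x - a = ∫ y, mollifier n hτ (x - y) * (G y - a) := by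
    conv_lhs => rw [← h1]
    unfold mollify
    rw [← integral_sub (integrable_mollifier_mul hτ hG x)
      (integrable_mollifier_mul hτ (locallyIntegrable_const a) x)]
    simp only [mul_sub]
  rw [h2]
  calc ‖∫ y, mollifier n hτ (x - y) * (G y - a)‖ₑ
      ≤ ∫⁻ y, ‖mollifier n hτ (x - y) * (G y - a)‖ₑ := enorm_integral_le_lintegral_enorm _
    _ ≤ ∫⁻ y, (cube b (4 * τ)).indicator
          (fun y => ENNReal.ofReal ((√n / τ) ^ n) * ‖G y - a‖ₑ) y := by
        refine lintegral_mono fun y => ?_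
        by_cases hy : y ∈ cube b (4 * τ)
        · rw [indicator_of_mem hy, enorm_mul, Real.enorm_of_nonneg (mollifier_nonneg hτ _)]
          gcongr
          exact mollifier_le hn hτ _
        · rw [mollifier_eq_zero hτ]
          · simp
          · rw [← dist_eq_norm]
            by_contra! hlt
            refine hy fun i => ?_
            have h3 := abs_sub_apply_le_dist y x i
            have h4 := hx i
            have h5 := abs_sub_le (y i) (x i) (b i)
            rw [dist_comm] at h3
            linarith
    _ = ENNReal.ofReal ((√n / τ) ^ n) * ∫⁻ y in cube b (4 * τ), ‖G y - a‖ₑ := by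
        rw [lintegral_indicator (measurableSet_cube _ _),
          lintegral_const_mul' _ _ ENNReal.ofReal_ne_top]
    _ = _ := by
        rw [← measure_mul_setLAverage _ (volume_cube_ne_top _ _), volume_cube, ← mul_assoc,
          ENNReal.ofReal_pow (by positivity), ← mul_pow, ← ENNReal.ofReal_mul (by positivity)]
        congr 3
        field_simp

/-- The constant of `enorm_mollify_sub_le`: the supremum of the mollifier at scale `τ` is at most
this constant divided by the volume of a cube of side `4 τ`. -/
def mollifyConst (n : ℕ) : ℝ≥0∞ := ENNReal.ofReal (4 * √n) ^ n

lemma meanOsc_sub_mollify_le (hn : 1 ≤ n) {τ : ℝ} (hτ : 0 < τ) {G : Eucl n → ℝ}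
    (hG : LocallyIntegrable G) {η : ℝ≥0∞}
    (hη : ∀ b l, 0 < l → l ≤ 4 * τ → meanOsc G (cube b l) ≤ η) {b : Eucl n} {l : ℝ} (hl : 0 < l)
    (hlτ : l < τ) : meanOsc (G - mollify hτ G) (cube b l) ≤ (1 + 2 * mollifyConst n) * η := by
  have hc := (contDiff_mollify hτ hG).continuous.locallyIntegrable (μ := volume)
  set a := ⨍ y in cube b (4 * τ), G y
  calc meanOsc (G - mollify hτ G) (cube b l)
      ≤ meanOsc G (cube b l) + meanOsc (mollify hτ G) (cube b l) :=
        meanOsc_sub_le (integrableOn_cube hG b hl.le) (integrableOn_cube hc b hl.le)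
    _ ≤ η + 2 * (mollifyConst n * η) := by
        refine add_le_add (hη b l hl (by linarith)) ?_
        refine (meanOsc_le_two_mul (integrableOn_cube hc b hl.le) (volume_cube_ne_zero b hl)
          (volume_cube_ne_top b l) a).trans ?_
        gcongr
        refine laverage_le_of_le (measurableSet_cube _ _) fun x hx => ?_
        refine (enorm_mollify_sub_le hn hτ hG (cube_mono (by linarith) hx) a).trans ?_
        unfold mollifyConst
        gcongr
        exact hη b (4 * τ) (by positivity) le_rfl
    _ = _ := by ring

lemma absAvg_sub_mollify_le (hn : 1 ≤ n) {τ : ℝ} (hτ : 0 < τ) {G : Eucl n → ℝ}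
    (hG : LocallyIntegrable G) {η : ℝ≥0∞}
    (hη : ∀ b l, 0 < l → l ≤ 4 * τ → meanOsc G (cube b l) ≤ η) {b : Eucl n} {l : ℝ}
    (hlτ : τ ≤ l) : absAvg (G - mollify hτ G) (cube b l) ≤ (4 ^ n + mollifyConst n) * η := by
  have hl : 0 < l := hτ.trans_le hlτ
  -- the cells of the grid have sidelength between `τ` and `2 * τ`
  set N := ⌊l / τ⌋₊ with hN
  have h1 : 1 ≤ l / τ := by rw [le_div_iff₀ hτ]; linarith
  have hN1 : 1 ≤ N := Nat.le_floor (by exact_mod_cast h1)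
  have hN1' : (1 : ℝ) ≤ N := by exact_mod_cast hN1
  have hNle : (N : ℝ) ≤ l / τ := Nat.floor_le (by positivity)
  have hNlt : l / τ < N + 1 := Nat.lt_floor_add_one _
  have hN0 : (0 : ℝ) < N := by linarith
  have hr1 : τ ≤ l / N := by
    rw [le_div_iff₀ hN0]
    rw [le_div_iff₀ hτ] at hNle
    linarith
  have hr2 : l / N ≤ 2 * τ := by
    rw [div_le_iff₀ hN0]
    rw [div_lt_iff₀ hτ] at hNlt
    nlinarith
  refine laverage_cube_le_of_grid hl hN1 fun c _ => ?_
  set r := l / N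
  have hr : 0 < r := hτ.trans_le hr1
  set a := ⨍ y in cube c (4 * τ), G y with ha
  have hosc : ⨍⁻ x in cube c (4 * τ), ‖G x - a‖ₑ ∂volume ≤ η := hη c (4 * τ) (by positivity) le_rfl
  calc ⨍⁻ x in cube c r, ‖(G - mollify hτ G) x‖ₑ ∂volume
      ≤ ⨍⁻ x in cube c r, (‖G x - a‖ₑ + mollifyConst n * η) ∂volume := by
        refine setLAverage_mono_on (measurableSet_cube _ _) fun x hx => ?_
        have h2 : (G - mollify hτ G) x = (G x - a) - (mollify hτ G x - a) := by simp
        rw [h2]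
        refine enorm_sub_le.trans ?_
        gcongr
        refine (enorm_mollify_sub_le hn hτ hG (cube_mono hr2 hx) a).trans ?_
        unfold mollifyConst
        gcongr
    _ = (⨍⁻ x in cube c r, ‖G x - a‖ₑ ∂volume) + mollifyConst n * η := by
        rw [setLAverage_add, setLAverage_const (volume_cube_ne_zero c hr) (volume_cube_ne_top c r)]
        exact ((integrableOn_cube hG c hr.le).aestronglyMeasurable.sub
          aestronglyMeasurable_const).enorm
    _ ≤ 4 ^ n * η + mollifyConst n * η := by
        gcongr
        refine (laverage_cube_le_mul (c' := c) (l' := 4 * τ) (A := 4) hr (cube_mono (by linarith))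
          (by linarith) _).trans ?_
        rw [ENNReal.ofReal_ofNat]
        gcongr
    _ = _ := by ring

lemma exists_lipschitzWith_mollify {τ : ℝ} (hτ : 0 < τ) {G : Eucl n → ℝ}
    (hG : LocallyIntegrable G) {B : ℝ≥0} (hB : ∀ x, ∫⁻ y in cube x (2 * τ), ‖G y‖ₑ ≤ B) :
    ∃ K : ℝ≥0, LipschitzWith K (mollify hτ G) := by
  obtain ⟨K, hK⟩ := (contDiff_mollifier (n := n) hτ).lipschitzWith_of_hasCompactSupport
    (hasCompactSupport_mollifier hτ) (by simp)
  refine ⟨K * (B + B), fun x y => ?_⟩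
  have hmem : ∀ x z : Eucl n, z ∉ cube x (2 * τ) → mollifier n hτ (x - z) = 0 := fun x z hz => by
    refine mollifier_eq_zero hτ ?_
    rw [← dist_eq_norm]
    by_contra! hlt
    exact hz (mem_cube_of_dist_le (by rw [dist_comm]; linarith))
  have h1 : mollify hτ G x - mollify hτ G y =
      ∫ z, (mollifier n hτ (x - z) - mollifier n hτ (y - z)) * G z := by
    unfold mollify
    rw [← integral_sub (integrable_mollifier_mul hτ hG x) (integrable_mollifier_mul hτ hG y)]
    simp only [sub_mul]
  rw [edist_eq_enorm_sub, h1]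
  calc ‖∫ z, (mollifier n hτ (x - z) - mollifier n hτ (y - z)) * G z‖ₑ
      ≤ ∫⁻ z, ‖(mollifier n hτ (x - z) - mollifier n hτ (y - z)) * G z‖ₑ :=
        enorm_integral_le_lintegral_enorm _
    _ ≤ ∫⁻ z, (cube x (2 * τ) ∪ cube y (2 * τ)).indicator
          (fun z => K * edist x y * ‖G z‖ₑ) z := by
        refine lintegral_mono fun z => ?_
        by_cases hz : z ∈ cube x (2 * τ) ∪ cube y (2 * τ)
        · rw [indicator_of_mem hz, enorm_mul]
          gcongr
          have := hK (x - z) (y - z)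
          rwa [edist_sub_right, edist_eq_enorm_sub] at this
        · rw [indicator_of_notMem hz, hmem x z fun h => hz (Or.inl h),
            hmem y z fun h => hz (Or.inr h)]
          simp
    _ = K * edist x y * ∫⁻ z in cube x (2 * τ) ∪ cube y (2 * τ), ‖G z‖ₑ := by
        rw [lintegral_indicator ((measurableSet_cube _ _).union (measurableSet_cube _ _)),
          lintegral_const_mul' _ _ (by finiteness)]
    _ ≤ K * edist x y * (B + B) := by
        gcongr
        exact (lintegral_union_le _ _ _).trans (add_le_add (hB x) (hB y))
    _ = _ := by push_cast; ring

/-! ### Approximation by smooth functions supported away from the boundary -/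

/-- A function of vanishing mean oscillation on an `(ε, δ)`-domain is approximated by mollifying its
product with a boundary cutoff. -/
lemma exists_smooth_approx {ε δ : ℝ} (hn : 1 ≤ n) (hε : 0 < ε) (hε1 : ε ≤ 1) (hδ : 0 < δ)
    {Ω : Set (Eucl n)} (hΩ : IsEpsDeltaDomain ε δ Ω) {f : Eucl n → ℝ}
    (hf : f ∈ bmoSpace Ω (scale n ε δ)) (hvmo : VanishingMeanOsc Ω f) {η : ℝ≥0∞} (hη : 0 < η) :
    ∃ g : Eucl n → ℝ, ContDiff ℝ ((⊤ : ℕ∞) : WithTop ℕ∞) g ∧ (∃ K : ℝ≥0, LipschitzWith K g) ∧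
      (∃ M : ℝ, ∀ x, |g x| ≤ M) ∧
      (∃ r : ℝ, 0 < r ∧ ∀ x, g x ≠ 0 → x ∈ Ω ∧
        ENNReal.ofReal r ≤ Metric.infEDist x (frontier Ω) ∧ ∃ y, dist x y ≤ 1 ∧ f y ≠ 0) ∧
      bmoNorm Ω (scale n ε δ) (f - g) ≤ η := by
  have hlam := scale_pos hn hε hδ
  obtain ⟨C, hC⟩ := exists_absAvg_le_logWeight hn hε hε1 hδ hΩ hf
  set lam := scale n ε δ with hlam'
  set T : ℝ≥0∞ := 2 + (1 + 2 * mollifyConst n) + 2 * (4 ^ n + mollifyConst n) +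
    (1 + (4 ^ n + mollifyConst n)) with hT
  have hKtop : mollifyConst n ≠ ⊤ := by unfold mollifyConst; finiteness
  have hTtop : T ≠ ⊤ := by finiteness
  have hη' : 0 < η / T := ENNReal.div_pos hη.ne' hTtop
  obtain ⟨φ, hφm, hφ01, ⟨s, hs0, hφs⟩, t, ht0, htl, hsmall, hlarge⟩ :=
    exists_boundary_cutoff hn hΩ.isOpen hf.1 hC hvmo hlam hη'
  have hTη : T * (η / T) ≤ η := ENNReal.mul_div_le
  set η' := η / T with hη'def
  have hφabs : ∀ x, |φ x| ≤ 1 := fun x => abs_le.2 ⟨by linarith [(hφ01 x).1], (hφ01 x).2⟩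
  have hfφ : ∀ (c : Eucl n) (l : ℝ), 0 < l → cube c l ⊆ Ω → IntegrableOn (f * φ) (cube c l) :=
    fun c l hl hsub => integrableOn_mul_of_bounded (hf.1 c l hl hsub) hφm hφabs
  set G : Eucl n → ℝ := Ω.indicator (f * φ) with hGdef
  have hGf : ∀ x, ‖G x‖ₑ ≤ ‖f x‖ₑ := fun x => by
    rw [hGdef, enorm_indicator_eq_indicator_enorm]
    refine (indicator_le_self _ _ x).trans ?_
    rw [Pi.mul_apply, enorm_mul]
    refine mul_le_of_le_one_right' ?_
    rw [Real.enorm_eq_ofReal_abs, ENNReal.ofReal_le_one]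
    exact hφabs x
  have hGne : ∀ y, G y ≠ 0 → y ∈ Ω ∧ f y ≠ 0 ∧
      ENNReal.ofReal s ≤ Metric.infEDist y (frontier Ω) := by
    intro y hy
    have hyΩ : y ∈ Ω := mem_of_indicator_ne_zero hy
    rw [hGdef, indicator_of_mem hyΩ, Pi.mul_apply] at hy
    refine ⟨hyΩ, left_ne_zero_of_mul hy, ofReal_le_infEDist_of_le_bdryDist ?_⟩
    by_contra! hlt
    exact right_ne_zero_of_mul hy (hφs y hyΩ hlt.le)
  have hn1 : (1 : ℝ) ≤ √n := by
    rw [Real.one_le_sqrt]; exact_mod_cast hn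
  obtain ⟨τ, hτ0, hτt, hτs, hτ1⟩ : ∃ τ : ℝ, 0 < τ ∧ 4 * τ < t ∧ √n * (4 * τ) < s ∧ τ ≤ 1 := by
    refine ⟨min (t / 8) (min (s / (8 * √n)) 1), by positivity, ?_, ?_, ?_⟩
    · linarith [min_le_left (t / 8) (min (s / (8 * √n)) 1)]
    · have h1 : min (t / 8) (min (s / (8 * √n)) 1) ≤ s / (8 * √n) :=
        (min_le_right _ _).trans (min_le_left _ _)
      rw [le_div_iff₀ (by positivity)] at h1
      linarith
    · exact (min_le_right _ _).trans (min_le_right _ _)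
  -- a small cube is contained in `Ω` or does not meet the support of `G`
  have hdich : ∀ b l, 0 < l → l ≤ 4 * τ → cube b l ⊆ Ω ∨ EqOn G 0 (cube b l) := by
    intro b l hl hlτ
    by_cases h : EqOn G 0 (cube b l)
    · exact Or.inr h
    left
    simp only [EqOn, not_forall] at h
    obtain ⟨y, hy, hGy⟩ := h
    obtain ⟨hyΩ, -, hys⟩ := hGne y hGy
    refine fun x hx => ball_subset_of_le_infEDist hΩ.isOpen hyΩ hys ?_
    have h1 := dist_le_of_mem_cube hl.le hx
    have h2 := dist_le_of_mem_cube hl.le hy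
    have h3 := dist_triangle_right x y b
    have h4 : √n * l ≤ √n * (4 * τ) := by gcongr
    rw [Metric.mem_ball]
    linarith
  have hGint : ∀ b l, 0 < l → l ≤ 4 * τ → IntegrableOn G (cube b l) := by
    intro b l hl hlτ
    rcases hdich b l hl hlτ with h | h
    · exact (hfφ b l hl h).congr_fun (fun x hx => (indicator_of_mem (h hx) _).symm)
        (measurableSet_cube _ _)
    · exact integrableOn_zero.congr_fun h.symm (measurableSet_cube _ _)
  have hG : LocallyIntegrable G := by
    intro x
    refine ⟨cube x (4 * τ), ?_, hGint x _ (by positivity) le_rfl⟩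
    refine mem_of_superset (Metric.ball_mem_nhds x (show 0 < 2 * τ by positivity)) fun y hy => ?_
    exact mem_cube_of_dist_le (by linarith [Metric.mem_ball.1 hy])
  have hGosc : ∀ b l, 0 < l → l ≤ 4 * τ → meanOsc G (cube b l) ≤ η' := by
    intro b l hl hlτ
    rcases hdich b l hl hlτ with h | h
    · rw [meanOsc_congr (measurableSet_cube _ _)
        (show EqOn G (f * φ) (cube b l) from fun x hx => indicator_of_mem (h hx) _)]
      exact (hsmall b l hl (by linarith) h).1
    · rw [meanOsc_congr (measurableSet_cube _ _) h, meanOsc_zero]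
      exact zero_le
  have hGavg : ∀ b l, 0 < l → l ≤ 4 * τ →
      absAvg G (cube b l) ≤ C * ENNReal.ofReal (logWeight l) := by
    intro b l hl hlτ
    rcases hdich b l hl hlτ with h | h
    · exact (lintegral_mono fun x => hGf x).trans (hC b l hl h)
    · rw [absAvg_congr (measurableSet_cube _ _) h, absAvg_zero]
      exact zero_le
  have hgc := (contDiff_mollify hτ0 hG).continuous.locallyIntegrable (μ := volume)
  refine ⟨mollify hτ0 G, contDiff_mollify hτ0 hG, ?_, ?_,
    ⟨s / 2, by positivity, fun x hx => ?_⟩, ?_⟩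
  · refine exists_lipschitzWith_mollify hτ0 hG
      (B := (C * ENNReal.ofReal (logWeight (2 * τ)) * ENNReal.ofReal (2 * τ) ^ n).toNNReal)
      fun x => ?_
    rw [ENNReal.coe_toNNReal (by finiteness), ← volume_cube x]
    exact setLIntegral_le_of_laverage_le (volume_cube_ne_top _ _)
      (hGavg x (2 * τ) (by positivity) (by linarith))
  · set B : ℝ≥0∞ := mollifyConst n * (C * ENNReal.ofReal (logWeight (4 * τ)))
    refine ⟨B.toReal, fun x => ?_⟩
    have h1 := enorm_mollify_sub_le hn hτ0 hG (center_mem_cube (c := x) (l := 2 * τ)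
      (by positivity)) 0
    simp only [sub_zero] at h1
    have h2 : ‖mollify hτ0 G x‖ₑ ≤ B := by
      exact h1.trans (mul_le_mul' le_rfl (hGavg x (4 * τ) (by positivity) le_rfl))
    rw [Real.enorm_eq_ofReal_abs] at h2
    exact (ENNReal.ofReal_le_iff_le_toReal (by finiteness)).1 h2
  · obtain ⟨y, hxy, hy⟩ := exists_ne_zero_of_mollify_ne_zero hτ0 hx
    obtain ⟨hyΩ, hfy, hys⟩ := hGne y hy
    have hτs' : τ ≤ s / 2 := by nlinarith
    refine ⟨ball_subset_of_le_infEDist hΩ.isOpen hyΩ hys (by rw [Metric.mem_ball]; linarith), ?_,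
      y, by linarith, hfy⟩
    refine (ENNReal.ofReal_le_ofReal ?_).trans
      (ofReal_sub_le_infEDist (x := y) (z := x) (b := τ) (by rw [dist_comm]; exact hxy.le) hys)
    linarith
  · have hdecomp : ∀ c l, cube c l ⊆ Ω →
        EqOn (f - mollify hτ0 G) ((f - f * φ) + (G - mollify hτ0 G)) (cube c l) := by
      intro c l h x hx
      have : G x = f x * φ x := indicator_of_mem (h hx) _
      simp only [Pi.sub_apply, Pi.add_apply, Pi.mul_apply, this]
      ring
    have hi1 : ∀ c l, 0 < l → cube c l ⊆ Ω → IntegrableOn (f - f * φ) (cube c l) :=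
      fun c l hl h => (hf.1 c l hl h).sub (hfφ c l hl h)
    have hi2 : ∀ (c : Eucl n) (l : ℝ), 0 < l → IntegrableOn (G - mollify hτ0 G) (cube c l) :=
      fun c l hl => (integrableOn_cube hG c hl.le).sub (integrableOn_cube hgc c hl.le)
    refine (bmoNorm_le (A := (2 + (1 + 2 * mollifyConst n) + 2 * (4 ^ n + mollifyConst n)) * η')
      (B := (1 + (4 ^ n + mollifyConst n)) * η') (fun c l hl hll hsub => ?_)
      (fun c l hl hll hsub => ?_)).trans ((add_mul _ _ _).symm.trans_le hTη)
    · rw [meanOsc_congr (measurableSet_cube _ _) (hdecomp c l hsub)]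
      refine (meanOsc_add_le (hi1 c l hl hsub) (hi2 c l hl)).trans ?_
      rw [add_assoc, add_mul]
      refine add_le_add ?_ ?_
      · rcases lt_or_ge l t with h | h
        · refine (hsmall c l hl h hsub).2.trans (le_mul_of_one_le_left' ?_)
          norm_num
        · refine (meanOsc_le_two_mul_absAvg (hi1 c l hl hsub) (volume_cube_ne_zero c hl)
            (volume_cube_ne_top c l)).trans ?_
          gcongr
          exact hlarge c l h hsub
      · rw [add_mul]
        rcases lt_or_ge l τ with h | h
        · exact (meanOsc_sub_mollify_le hn hτ0 hG hGosc hl h).trans le_self_add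
        · refine le_trans ?_ le_add_self
          refine (meanOsc_le_two_mul_absAvg (hi2 c l hl) (volume_cube_ne_zero c hl)
            (volume_cube_ne_top c l)).trans ?_
          rw [mul_assoc]
          gcongr
          exact absAvg_sub_mollify_le hn hτ0 hG hGosc h
    · rw [absAvg_congr (measurableSet_cube _ _) (hdecomp c l hsub)]
      refine (absAvg_add_le (hi1 c l hl hsub)).trans ?_
      rw [add_mul, one_mul]
      exact add_le_add (hlarge c l (htl.trans hll) hsub)
        (absAvg_sub_mollify_le hn hτ0 hG hGosc (by linarith))

lemma mem_bmoSpace_of_bounded {Ω : Set (Eucl n)} {lam : ℝ} {g : Eucl n → ℝ} (hg : Continuous g)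
    {M : ℝ} (hM : ∀ x, |g x| ≤ M) : g ∈ bmoSpace Ω lam := by
  have hi : ∀ (c : Eucl n) (l : ℝ), 0 < l → IntegrableOn g (cube c l) := fun c l hl =>
    integrableOn_cube hg.locallyIntegrable c hl.le
  have hb : ∀ (c : Eucl n) (l : ℝ), absAvg g (cube c l) ≤ ENNReal.ofReal M := fun c l =>
    laverage_le_of_le (measurableSet_cube _ _) fun x _ => by
      rw [Real.enorm_eq_ofReal_abs]
      exact ENNReal.ofReal_le_ofReal (hM x)
  refine ⟨fun c l hl _ => hi c l hl, ?_⟩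
  refine (bmoNorm_le (A := 2 * ENNReal.ofReal M) (B := ENNReal.ofReal M) (fun c l hl _ _ => ?_)
    (fun c l _ _ _ => hb c l)).trans_lt (by finiteness)
  refine (meanOsc_le_two_mul_absAvg (hi c l hl) (volume_cube_ne_zero c hl)
    (volume_cube_ne_top c l)).trans ?_
  gcongr
  exact hb c l

/-! ### Vanishing mean oscillation -/

lemma vanishingMeanOsc_iff {Ω : Set (Eucl n)} {f : Eucl n → ℝ} : VanishingMeanOsc Ω f ↔
    ∀ η : ℝ≥0∞, 0 < η → ∃ t : ℝ, 0 < t ∧ modulus Ω f t ≤ η := by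
  refine ⟨fun h η hη => ?_, fun h => ENNReal.tendsto_nhds_zero.2 fun η hη => ?_⟩
  · obtain ⟨t, h1, -, h2⟩ := exists_modulus_le h hη one_pos
    exact ⟨t, h1, h2⟩
  · obtain ⟨t, h1, h2⟩ := h η hη
    filter_upwards [Ioc_mem_nhdsGT h1] with s hs
    exact (modulus_mono Ω f hs.2).trans h2

lemma vanishingMeanOsc_of_uniformContinuousOn {Ω : Set (Eucl n)} {g : Eucl n → ℝ}
    (hi : ∀ (c : Eucl n) (l : ℝ), 0 < l → cube c l ⊆ Ω → IntegrableOn g (cube c l))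
    (hg : UniformContinuousOn g Ω) : VanishingMeanOsc Ω g := by
  rw [vanishingMeanOsc_iff]
  intro η hη
  obtain ⟨κ, hκ0, -, hκ⟩ := exists_pos_mul_ofReal_le (X := 2) (by simp) hη
  obtain ⟨d, hd0, hd⟩ := Metric.uniformContinuousOn_iff.1 hg κ hκ0
  have hs : 0 ≤ √(n : ℝ) := Real.sqrt_nonneg _
  refine ⟨d / (√n + 1), by positivity, modulus_le fun c l hl hlt hsub => ?_⟩
  refine (meanOsc_le_two_mul (hi c l hl hsub) (volume_cube_ne_zero c hl) (volume_cube_ne_top c l)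
    (g c)).trans (le_trans ?_ hκ)
  gcongr
  refine laverage_le_of_le (measurableSet_cube _ _) fun x hx => ?_
  rw [← edist_eq_enorm_sub, edist_dist]
  refine ENNReal.ofReal_le_ofReal (hd x (hsub hx) c (hsub (center_mem_cube hl.le)) ?_).le
  refine (dist_le_of_mem_cube hl.le hx).trans_lt ?_
  rw [lt_div_iff₀ (by positivity)] at hlt
  nlinarith

lemma vanishingMeanOsc_of_approx {Ω : Set (Eucl n)} {lam : ℝ} (hlam : 0 < lam) {f : Eucl n → ℝ}
    (hf : f ∈ bmoSpace Ω lam)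
    (h : ∀ η : ℝ≥0∞, 0 < η → ∃ g ∈ bmoSpace Ω lam, VanishingMeanOsc Ω g ∧
      bmoNorm Ω lam (f - g) < η) : VanishingMeanOsc Ω f := by
  rw [vanishingMeanOsc_iff]
  intro η hη
  have hη2 : 0 < η / 2 := ENNReal.half_pos hη.ne'
  obtain ⟨g, hg, hvg, hfg⟩ := h _ hη2
  obtain ⟨t, ht0, htl, ht⟩ := exists_modulus_le hvg hη2 hlam
  refine ⟨t, ht0, modulus_le fun c l hl hlt hsub => ?_⟩
  have hfi := hf.1 c l hl hsub
  have hgi := hg.1 c l hl hsub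
  calc meanOsc f (cube c l) = meanOsc ((f - g) + g) (cube c l) := by rw [sub_add_cancel]
    _ ≤ meanOsc (f - g) (cube c l) + meanOsc g (cube c l) := meanOsc_add_le (hfi.sub hgi) hgi
    _ ≤ η / 2 + η / 2 := add_le_add
        ((meanOsc_le_bmoNorm _ hl (hlt.trans_le htl) hsub).trans hfg.le)
        ((meanOsc_le_modulus g hl hlt hsub).trans ht)
    _ = η := ENNReal.add_halves η

lemma vanishesAtInfinity_of_approx {Ω : Set (Eucl n)} {lam : ℝ} {f : Eucl n → ℝ}
    (h : ∀ η : ℝ≥0∞, 0 < η → ∃ g : Eucl n → ℝ, HasCompactSupport g ∧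
      bmoNorm Ω lam (f - g) < η) : VanishesAtInfinity Ω lam f := by
  refine ENNReal.tendsto_nhds_zero.2 fun η hη => ?_
  obtain ⟨g, hg, hfg⟩ := h η hη
  obtain ⟨R, hR⟩ := hg.isBounded.subset_closedBall 0
  filter_upwards [eventually_ge_atTop R] with S hS
  have he : EqOn f (f - g) (Ω \ Metric.closedBall 0 S) := fun x hx => by
    have : g x = 0 := by
      by_contra hgx
      exact hx.2 (Metric.closedBall_subset_closedBall hS (hR (subset_tsupport g hgx)))
    simp [this]
  exact ((bmoNorm_congr lam he).trans (bmoNorm_mono sdiff_subset lam _)).trans hfg.le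

/-! ### Cutting off at infinity -/

/-- The cutoff function with slope `κ` in `‖x‖`, equal to `1` on the ball of radius `R`. -/
def radialCutoff (n : ℕ) (κ R : ℝ) (x : Eucl n) : ℝ := max 0 (min 1 (1 - κ * (‖x‖ - R)))

lemma measurable_radialCutoff (κ R : ℝ) : Measurable (radialCutoff n κ R) := by
  unfold radialCutoff; fun_prop

lemma abs_radialCutoff_le (κ R : ℝ) (x : Eucl n) : |radialCutoff n κ R x| ≤ 1 :=
  abs_le.2 ⟨(by norm_num : (-1 : ℝ) ≤ 0).trans (le_max_left _ _),
    max_le zero_le_one (min_le_left _ _)⟩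

lemma radialCutoff_eq_one {κ R : ℝ} (hκ : 0 < κ) {x : Eucl n} (hx : ‖x‖ ≤ R) :
    radialCutoff n κ R x = 1 := by
  have : 1 ≤ 1 - κ * (‖x‖ - R) := by nlinarith
  unfold radialCutoff
  rw [min_eq_left this, max_eq_right zero_le_one]

lemma norm_le_of_radialCutoff_ne_zero {κ R : ℝ} (hκ : 0 < κ) {x : Eucl n}
    (hx : radialCutoff n κ R x ≠ 0) : ‖x‖ ≤ R + 1 / κ := by
  by_contra! hlt
  have h1 : κ * (1 / κ) ≤ κ * (‖x‖ - R) := by gcongr; linarith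
  rw [mul_one_div_cancel hκ.ne'] at h1
  exact hx (max_eq_left ((min_le_right _ _).trans (by linarith)))

lemma laverage_radialCutoff_sub_le {κ R : ℝ} (hκ : 0 < κ) (c : Eucl n) {l : ℝ} (hl : 0 < l) :
    ⨍⁻ x in cube c l, ‖radialCutoff n κ R x - radialCutoff n κ R c‖ₑ ∂volume ≤
      ENNReal.ofReal (κ * (√n * l)) := by
  refine laverage_le_of_le (measurableSet_cube _ _) fun x hx => ?_
  rw [Real.enorm_eq_ofReal_abs]
  apply ENNReal.ofReal_le_ofReal
  refine (abs_max_min_sub_le _ _).trans ?_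
  have h1 : 1 - κ * (‖x‖ - R) - (1 - κ * (‖c‖ - R)) = -(κ * (‖x‖ - ‖c‖)) := by ring
  rw [h1, abs_neg, abs_mul, abs_of_pos hκ]
  gcongr
  have h2 := abs_norm_sub_norm_le x c
  rw [← dist_eq_norm] at h2
  have h3 := dist_le_of_mem_cube hl.le hx
  have h4 : 0 ≤ √(n : ℝ) * l := by positivity
  linarith

lemma mul_logWeight_le {l : ℝ} (hl : 0 < l) : l * logWeight l ≤ 1 + l := by
  unfold logWeight
  rcases le_or_gt 1 l with h | h
  · rw [min_eq_right h, Real.log_one]; linarith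
  · rw [min_eq_left h.le]
    have h1 := Real.log_le_sub_one_of_pos (inv_pos.2 hl)
    rw [Real.log_inv] at h1
    have h2 : l * -Real.log l ≤ l * (l⁻¹ - 1) := by gcongr
    rw [mul_sub, mul_inv_cancel₀ hl.ne'] at h2
    linarith

/-- The averages of `|f|` may be large on small cubes, but they grow slower than the oscillation of
a Lipschitz cutoff decreases. -/
lemma meanOsc_mul_radialCutoff_le {Ω : Set (Eucl n)} {f : Eucl n → ℝ}
    (hf : ∀ (c : Eucl n) (l : ℝ), 0 < l → cube c l ⊆ Ω → IntegrableOn f (cube c l)) {C : ℝ≥0}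
    (hC : ∀ c l, 0 < l → cube c l ⊆ Ω →
      absAvg f (cube c l) ≤ C * ENNReal.ofReal (logWeight l)) {κ : ℝ} (hκ : 0 < κ) (R : ℝ)
    {c : Eucl n} {l : ℝ} (hl : 0 < l) (hsub : cube c l ⊆ Ω) :
    meanOsc (f * radialCutoff n κ R) (cube c l) ≤
      2 * (meanOsc f (cube c l) + C * ENNReal.ofReal (κ * √n * (l * logWeight l))) := by
  refine (meanOsc_mul_le (measurableSet_cube _ _) (hf c l hl hsub) (integrableOn_mul_of_bounded
    (hf c l hl hsub) (measurable_radialCutoff κ R) (abs_radialCutoff_le κ R))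
    (fun x _ => abs_radialCutoff_le κ R x) (volume_cube_ne_zero c hl) (volume_cube_ne_top c l)
    (radialCutoff n κ R c)).trans ?_
  refine mul_le_mul' le_rfl (add_le_add le_rfl ?_)
  calc _ ≤ C * ENNReal.ofReal (logWeight l) * ENNReal.ofReal (κ * (√n * l)) :=
        mul_le_mul' (hC c l hl hsub) (laverage_radialCutoff_sub_le hκ c hl)
    _ = _ := by
      rw [mul_assoc, ← ENNReal.ofReal_mul (logWeight_pos hl).le]
      congr 2
      ring

lemma vanishingMeanOsc_mul_radialCutoff {Ω : Set (Eucl n)} {f : Eucl n → ℝ}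
    (hf : ∀ (c : Eucl n) (l : ℝ), 0 < l → cube c l ⊆ Ω → IntegrableOn f (cube c l)) {C : ℝ≥0}
    (hC : ∀ c l, 0 < l → cube c l ⊆ Ω →
      absAvg f (cube c l) ≤ C * ENNReal.ofReal (logWeight l))
    (hvmo : VanishingMeanOsc Ω f) {κ : ℝ} (hκ : 0 < κ) (R : ℝ) :
    VanishingMeanOsc Ω (f * radialCutoff n κ R) := by
  rw [vanishingMeanOsc_iff]
  intro η hη
  have h4 : 0 < η / 4 := ENNReal.div_pos hη.ne' (by simp)
  obtain ⟨κ', hκ'0, -, hκ'⟩ := exists_pos_mul_ofReal_le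
    (X := C * ENNReal.ofReal (κ * √n)) (by finiteness) h4
  obtain ⟨s, hs0, -, -, hs⟩ := exists_pos_mul_logWeight_le hκ'0 one_pos
  obtain ⟨t, ht0, hts, ht⟩ := exists_modulus_le hvmo h4 hs0
  refine ⟨t, ht0, modulus_le fun c l hl hlt hsub => ?_⟩
  refine (meanOsc_mul_radialCutoff_le hf hC hκ R hl hsub).trans ?_
  calc _ ≤ 2 * (η / 4 + C * (ENNReal.ofReal (κ * √n) * ENNReal.ofReal κ')) := by
        rw [← ENNReal.ofReal_mul (by positivity)]
        gcongr
        · exact (meanOsc_le_modulus f hl hlt hsub).trans ht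
        · exact hs l hl (hlt.le.trans hts)
    _ ≤ 2 * (η / 4 + η / 4) := by
        rw [← mul_assoc (C : ℝ≥0∞)]
        gcongr
    _ = 4 * (η / 4) := by ring
    _ = η := ENNReal.mul_div_cancel (by simp) (by simp)

lemma bmoNorm_neg (Ω : Set (Eucl n)) (lam : ℝ) (f : Eucl n → ℝ) :
    bmoNorm Ω lam (-f) = bmoNorm Ω lam f := by
  simp only [bmoNorm, modulus, meanOsc_neg, absAvg, Pi.neg_apply, enorm_neg]

/-- A function vanishing at infinity is approximated by its products with slowly varying radial
cutoff functions. -/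
lemma exists_radialCutoff_approx {Ω : Set (Eucl n)} {lam : ℝ} (hlam : 0 < lam) {f : Eucl n → ℝ}
    (hf : f ∈ bmoSpace Ω lam) {C : ℝ≥0}
    (hC : ∀ c l, 0 < l → cube c l ⊆ Ω →
      absAvg f (cube c l) ≤ C * ENNReal.ofReal (logWeight l))
    (hinf : VanishesAtInfinity Ω lam f) {η : ℝ≥0∞} (hη : 0 < η) :
    ∃ κ > 0, ∃ R, bmoNorm Ω lam (f - f * radialCutoff n κ R) ≤ η := by
  have h8 : 0 < η / 8 := ENNReal.div_pos hη.ne' (by simp)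
  obtain ⟨R, hR⟩ := (hinf.eventually (gt_mem_nhds h8)).exists
  obtain ⟨κ, hκ0, -, hκ⟩ := exists_pos_mul_ofReal_le
    (X := C * ENNReal.ofReal (√n * (1 + lam))) (by finiteness) h8
  set ψ := radialCutoff n κ (R + √n * (2 * lam)) with hψ
  have hi : ∀ (c : Eucl n) (l : ℝ), 0 < l → cube c l ⊆ Ω → IntegrableOn (f * ψ) (cube c l) :=
    fun c l hl hsub => integrableOn_mul_of_bounded (hf.1 c l hl hsub) (measurable_radialCutoff _ _)
      (abs_radialCutoff_le _ _)
  -- a cube of side at most `2 * lam` avoids the ball of radius `R`, or lies where `ψ = 1`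
  have hdich : ∀ c l, 0 < l → l ≤ 2 * lam → cube c l ⊆ Ω →
      cube c l ⊆ Ω \ Metric.closedBall 0 R ∨ EqOn (f - f * ψ) 0 (cube c l) := by
    intro c l hl hll hsub
    by_cases h : ∀ y ∈ cube c l, y ∉ Metric.closedBall (0 : Eucl n) R
    · exact Or.inl fun y hy => ⟨hsub hy, h y hy⟩
    right
    push Not at h
    obtain ⟨y, hy, hyR⟩ := h
    intro x hx
    have h1 := dist_le_of_mem_cube hl.le hx
    have h2 := dist_le_of_mem_cube hl.le hy
    have h3 := dist_triangle_right x y c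
    have h4 := dist_triangle x y 0
    have h5 : √n * l ≤ √n * (2 * lam) := by gcongr
    have h6 : ψ x = 1 := radialCutoff_eq_one hκ0 (by
      rw [← dist_zero_right]
      linarith [Metric.mem_closedBall.1 hyR])
    simp [h6]
  have habs : ∀ c l, lam ≤ l → l ≤ 2 * lam → cube c l ⊆ Ω →
      absAvg (f - f * ψ) (cube c l) ≤ η / 8 := by
    intro c l hl hll hsub
    rcases hdich c l (by linarith) hll hsub with h | h
    · refine le_trans (lintegral_mono fun x => ?_)
        ((absAvg_le_bmoNorm f (by linarith) hl h).trans hR.le)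
      have h1 : (f - f * ψ) x = f x * (1 - ψ x) := by simp; ring
      rw [h1, enorm_mul]
      refine mul_le_of_le_one_right' ?_
      rw [Real.enorm_eq_ofReal_abs, ENNReal.ofReal_le_one, abs_le]
      have h2 : 0 ≤ ψ x := le_max_left _ _
      have h3 : ψ x ≤ 1 := max_le zero_le_one (min_le_left _ _)
      constructor <;> linarith
    · rw [absAvg_congr (measurableSet_cube _ _) h, absAvg_zero]
      exact zero_le
  refine ⟨κ, hκ0, R + √n * (2 * lam), (bmoNorm_le (A := 5 * (η / 8)) (B := η / 8)
    (fun c l hl hll hsub => ?_) (fun c l hl hll hsub => ?_)).trans ?_⟩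
  · rcases hdich c l hl (by linarith) hsub with h | h
    · have hosc : meanOsc f (cube c l) ≤ η / 8 := (meanOsc_le_bmoNorm f hl hll h).trans hR.le
      refine (meanOsc_sub_le (hf.1 c l hl hsub) (hi c l hl hsub)).trans ?_
      calc _ ≤ η / 8 + 2 * (η / 8 +
            C * (ENNReal.ofReal (√n * (1 + lam)) * ENNReal.ofReal κ)) := by
            refine add_le_add hosc ((meanOsc_mul_radialCutoff_le hf.1 hC hκ0 _ hl hsub).trans ?_)
            rw [← ENNReal.ofReal_mul (by positivity)]
            refine mul_le_mul' le_rfl (add_le_add hosc (mul_le_mul' le_rfl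
              (ENNReal.ofReal_le_ofReal ?_)))
            calc κ * √n * (l * logWeight l) ≤ κ * √n * (1 + lam) := by
                  gcongr
                  linarith [mul_logWeight_le hl]
              _ = _ := by ring
        _ ≤ η / 8 + 2 * (η / 8 + η / 8) := by
            rw [← mul_assoc (C : ℝ≥0∞)]
            gcongr
        _ = _ := by ring
    · rw [meanOsc_congr (measurableSet_cube _ _) h, meanOsc_zero]
      exact zero_le
  · have h1 : 1 ≤ l / lam := by rw [le_div_iff₀ hlam]; linarith
    have hN1 : 1 ≤ ⌊l / lam⌋₊ := Nat.le_floor (by exact_mod_cast h1)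
    have hN1' : (1 : ℝ) ≤ ⌊l / lam⌋₊ := by exact_mod_cast hN1
    have hNle : (⌊l / lam⌋₊ : ℝ) ≤ l / lam := Nat.floor_le (by positivity)
    have hNlt : l / lam < ⌊l / lam⌋₊ + 1 := Nat.lt_floor_add_one _
    refine laverage_cube_le_of_grid hl hN1 fun b hb => habs b _ ?_ ?_ (hb.trans hsub)
    · rw [le_div_iff₀ (by linarith)]
      rw [le_div_iff₀ hlam] at hNle
      linarith
    · rw [div_le_iff₀ (by linarith)]
      rw [div_lt_iff₀ hlam] at hNlt
      nlinarith
  · calc 5 * (η / 8) + η / 8 = 6 * (η / 8) := by ring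
      _ ≤ 8 * (η / 8) := by gcongr; norm_num
      _ = η := ENNReal.mul_div_cancel (by simp) (by simp)

lemma tsupport_subset_of_le_infEDist {Ω : Set (Eucl n)} (hΩ : IsOpen Ω) {g : Eucl n → ℝ} {r : ℝ}
    (hr : 0 < r)
    (hg : ∀ x, g x ≠ 0 → x ∈ Ω ∧ ENNReal.ofReal r ≤ Metric.infEDist x (frontier Ω)) :
    tsupport g ⊆ Ω := by
  have hcl : IsClosed (closure Ω ∩ {x | ENNReal.ofReal r ≤ Metric.infEDist x (frontier Ω)}) :=
    isClosed_closure.inter (isClosed_le continuous_const Metric.continuous_infEDist)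
  intro x hx
  obtain ⟨h1, h2⟩ := closure_minimal (s := Function.support g)
    (fun y hy => mem_inter (subset_closure (hg y hy).1) (hg y hy).2) hcl hx
  by_contra hxΩ
  have h3 : x ∈ frontier Ω := by rw [hΩ.frontier_eq]; exact ⟨h1, hxΩ⟩
  have h4 : ENNReal.ofReal r ≤ Metric.infEDist x (frontier Ω) := h2
  rw [Metric.infEDist_zero_of_mem h3, nonpos_iff_eq_zero, ENNReal.ofReal_eq_zero] at h4
  linarith

/-- A function vanishing at infinity, of vanishing mean oscillation, is approximated by smooth
functions with compact support: cut off at infinity, then near the boundary, and mollify. -/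
lemma exists_smoothCompactSupp_approx {ε δ : ℝ} (hn : 1 ≤ n) (hε : 0 < ε) (hε1 : ε ≤ 1)
    (hδ : 0 < δ) {Ω : Set (Eucl n)} (hΩ : IsEpsDeltaDomain ε δ Ω) {f : Eucl n → ℝ}
    (hf : f ∈ bmoSpace Ω (scale n ε δ)) (hinf : VanishesAtInfinity Ω (scale n ε δ) f)
    (hvmo : VanishingMeanOsc Ω f) {η : ℝ≥0∞} (hη : 0 < η) :
    ∃ g ∈ smoothCompactSupp Ω, g ∈ bmoSpace Ω (scale n ε δ) ∧
      bmoNorm Ω (scale n ε δ) (f - g) ≤ η := by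
  have hlam := scale_pos hn hε hδ
  obtain ⟨C, hC⟩ := exists_absAvg_le_logWeight hn hε hε1 hδ hΩ hf
  set lam := scale n ε δ with hlam'
  have hη2 : 0 < min (η / 2) 1 := lt_min (ENNReal.half_pos hη.ne') one_pos
  obtain ⟨κ, hκ, R, hR⟩ := exists_radialCutoff_approx hlam hf hC hinf hη2
  set h := f * radialCutoff n κ R with hh
  have hi : ∀ (c : Eucl n) (l : ℝ), 0 < l → cube c l ⊆ Ω → IntegrableOn h (cube c l) :=
    fun c l hl hsub => integrableOn_mul_of_bounded (hf.1 c l hl hsub) (measurable_radialCutoff _ _)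
      (abs_radialCutoff_le _ _)
  have hfh : ∀ (c : Eucl n) (l : ℝ), 0 < l → cube c l ⊆ Ω → IntegrableOn (f - h) (cube c l) :=
    fun c l hl hsub => (hf.1 c l hl hsub).sub (hi c l hl hsub)
  have hh_mem : h ∈ bmoSpace Ω lam := by
    refine ⟨hi, ?_⟩
    have h1 : h = f + -(f - h) := by ring
    rw [h1]
    refine (bmoNorm_add_le hf.1 fun c l hl hsub => (hfh c l hl hsub).neg).trans_lt ?_
    rw [bmoNorm_neg]
    exact ENNReal.add_lt_top.2 ⟨hf.2, (hR.trans (min_le_right _ _)).trans_lt ENNReal.one_lt_top⟩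
  obtain ⟨g, hgs, -, ⟨M, hM⟩, ⟨r, hr, hg⟩, hgn⟩ := exists_smooth_approx hn hε hε1 hδ hΩ hh_mem
    (vanishingMeanOsc_mul_radialCutoff hf.1 hC hvmo hκ R) (ENNReal.half_pos hη.ne')
  have hgmem : g ∈ bmoSpace Ω lam := mem_bmoSpace_of_bounded hgs.continuous hM
  refine ⟨g, ⟨hgs, ?_, tsupport_subset_of_le_infEDist hΩ.isOpen hr
    fun x hx => ⟨(hg x hx).1, (hg x hx).2.1⟩⟩, hgmem, ?_⟩
  · refine HasCompactSupport.intro (isCompact_closedBall (0 : Eucl n) (R + 1 / κ + 1))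
      fun x hx => ?_
    by_contra hgx
    obtain ⟨-, -, y, hxy, hy⟩ := hg x hgx
    have h1 := norm_le_of_radialCutoff_ne_zero hκ (right_ne_zero_of_mul hy)
    have h2 := dist_triangle x y 0
    rw [dist_zero_right y] at h2
    exact hx (Metric.mem_closedBall.2 (by linarith))
  · have h1 : f - g = (f - h) + (h - g) := by ring
    rw [h1]
    calc _ ≤ bmoNorm Ω lam (f - h) + bmoNorm Ω lam (h - g) :=
          bmoNorm_add_le hfh fun c l hl hsub => (hi c l hl hsub).sub (hgmem.1 c l hl hsub)
      _ ≤ η / 2 + η / 2 := add_le_add (hR.trans (min_le_left _ _)) hgn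
      _ = η := ENNReal.add_halves η

lemma vanishingMeanOsc_of_mem_closure_contCompactSupp {Ω : Set (Eucl n)} {lam : ℝ}
    (hlam : 0 < lam) {f : Eucl n → ℝ} (hf : f ∈ bmoClosure Ω lam (contCompactSupp Ω)) :
    VanishingMeanOsc Ω f :=
  vanishingMeanOsc_of_approx hlam hf.1 fun η hη => by
    obtain ⟨g, ⟨hgc, hgs, -⟩, hgm, hfg⟩ := hf.2 η hη
    exact ⟨g, hgm, vanishingMeanOsc_of_uniformContinuousOn hgm.1
      (hgs.uniformContinuous_of_continuous hgc).uniformContinuousOn, hfg⟩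

end LocalBmo

end

theorem proposition4 (n : ℕ) (hn : 1 ≤ n) (ε δ : ℝ) (hε : 0 < ε) (hε1 : ε ≤ 1) (hδ : 0 < δ)
    (Ω : Set (LocalBmo.Eucl n)) (hΩ : LocalBmo.IsEpsDeltaDomain ε δ Ω)
    (f : LocalBmo.Eucl n → ℝ) (hf : f ∈ LocalBmo.bmoSpace Ω (LocalBmo.scale n ε δ)) :
    (f ∈ LocalBmo.bmoClosure Ω (LocalBmo.scale n ε δ) (LocalBmo.lipBoundedAway Ω) ↔
      LocalBmo.VanishingMeanOsc Ω f) ∧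
    List.TFAE [
      f ∈ LocalBmo.bmoClosure Ω (LocalBmo.scale n ε δ) (LocalBmo.contCompactSupp Ω),
      f ∈ LocalBmo.bmoClosure Ω (LocalBmo.scale n ε δ) (LocalBmo.smoothCompactSupp Ω),
      LocalBmo.VanishesAtInfinity Ω (LocalBmo.scale n ε δ) f ∧
        LocalBmo.VanishingMeanOsc Ω f] := by
  have hlam := LocalBmo.scale_pos hn hε hδ
  refine ⟨⟨fun h => ?_, fun h => ⟨hf, fun η hη => ?_⟩⟩, ?_⟩
  · refine LocalBmo.vanishingMeanOsc_of_approx hlam hf fun η hη => ?_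
    obtain ⟨g, ⟨-, ⟨K, hK⟩, -⟩, hgm, hfg⟩ := h.2 η hη
    exact ⟨g, hgm, LocalBmo.vanishingMeanOsc_of_uniformContinuousOn hgm.1
      hK.uniformContinuousOn, hfg⟩
  · obtain ⟨η', hη'0, hη'⟩ := exists_between hη
    obtain ⟨g, hgs, ⟨K, hK⟩, ⟨M, hM⟩, ⟨r, hr, hg⟩, hgn⟩ :=
      LocalBmo.exists_smooth_approx hn hε hε1 hδ hΩ hf h hη'0
    exact ⟨g, ⟨⟨M, fun x _ => hM x⟩, ⟨K, hK.lipschitzOnWith⟩, ENNReal.ofReal r,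
      ENNReal.ofReal_pos.2 hr, fun x _ hx => (hg x hx).2.1⟩,
      LocalBmo.mem_bmoSpace_of_bounded hgs.continuous hM, hgn.trans_lt hη'⟩
  · tfae_have 2 → 1 := fun h => ⟨hf, fun η hη => by
      obtain ⟨g, ⟨hgs, hgc, hgt⟩, hgm, hfg⟩ := h.2 η hη
      exact ⟨g, ⟨hgs.continuous, hgc, hgt⟩, hgm, hfg⟩⟩
    tfae_have 1 → 3 := fun h =>
      ⟨LocalBmo.vanishesAtInfinity_of_approx fun η hη => by
        obtain ⟨g, ⟨-, hgc, -⟩, -, hfg⟩ := h.2 η hη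
        exact ⟨g, hgc, hfg⟩,
      LocalBmo.vanishingMeanOsc_of_mem_closure_contCompactSupp hlam h⟩
    tfae_have 3 → 2 := fun h => ⟨hf, fun η hη => by
      obtain ⟨η', hη'0, hη'⟩ := exists_between hη
      obtain ⟨g, hg, hgm, hfg⟩ :=
        LocalBmo.exists_smoothCompactSupp_approx hn hε hε1 hδ hΩ hf h.1 h.2 hη'0
      exact ⟨g, hg, hgm, hfg.trans_lt hη'⟩⟩
    tfae_finish
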